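/- Let $M$ be a smooth manifold with a smooth involution $\tau\colon M\to M$, and let $M^\tau$ be its fixed point set. For $\epsilon\in\mathbb Z_2=\{0,1\}$ let $\mathcal U^\epsilon$ be the $\mathbb Z_2$-equivariant sheaf of smooth $U(1)$-valued functions on $M$, where $\mathbb Z_2$ acts on $M$ by $\tau$, and on $U(1)$ trivially if $\epsilon=0$ and by complex conjugation if $\epsilon=1$. Let $\mathcal U(1)$ be the underlying non-equivariant sheaf. Let $H^k(M;\mathbb Z_2,\mathcal F)$ denote (Grothendieck) equivariant sheaf cohomology, i.e. the right derived functors of $\mathcal F\mapsto\Gamma(M,\mathcal F)^{\mathbb Z_2}$, and write $[k]$ for $k$ modulo $2$. The short exact sequence of equivariant sheaves $$0\to\mathcal U^\epsilon\to \mathrm{ind}\,\mathcal U(1)\xrightarrow{1\times\tau^*}\mathcal U^{[\epsilon+1]}\to 0,$$ where $(\mathrm{ind}\,\mathcal U(1))(U)=\mathcal U(1)(U)\times\mathcal U(1)(\tau U)$ is the equivariant sheaf induced from $\mathcal U(1)$, so that $H^k(M;\mathbb Z_2,\mathrm{ind}\,\mathcal U(1))=H^k(M,\mathcal U(1))$,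 gives the long exact sequence $$\cdots\to H^k(M;\mathbb Z_2,\mathcal U^\epsilon)\to H^k(M,\mathcal U(1))\xrightarrow{1\times\tau^*}H^k(M;\mathbb Z_2,\mathcal U^{[\epsilon+1]})\to H^{k+1}(M;\mathbb Z_2,\mathcal U^\epsilon)\to\cdots .$$ For an integer $p\ge -1$ let $$\partial_{p+2}\colon H^{p+1}(M;\mathbb Z_2,\mathcal U^{[p+2]})\to H^{p+2}(M;\mathbb Z_2,\mathcal U^{[p+3]})$$ be its connecting homomorphism. Then: 1. For every $p\ge -1$ the group $H^{p+1}(\mathrm{pt};\mathbb Z_2,\mathcal U^{[p+2]})$ of a one-point manifold is isomorphic to $\mathbb Z_2$ (by a unique isomorphism). For a fixed point $m\in M^\tau$ with inclusion $\iota_m\colon\{m\}\hookrightarrow M$, put $$\sigma_{p+1}(\xi)(m)=\iota_m^*\xi\in H^{p+1}(\{m\};\mathbb Z_2,\mathcal U^{[p+2]})=\mathbb Z_2,\qquad \xi\in H^{p+1}(M;\mathbb Z_2,\mathcal U^{[p+2]}).$$ 2. For every $\xi$ the function $\sigma_{p+1}(\xi)\colon M^\tau\to\mathbb Z_2$ is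 locally constant, so that $\sigma_{p+1}$ is a homomorphism $H^{p+1}(M;\mathbb Z_2,\mathcal U^{[p+2]})\to H^0(M^\tau,\mathbb Z_2)$ (the sign choice map). 3. For every $p\ge -1$, $$\sigma_{p+2}\circ\partial_{p+2}=\sigma_{p+1}.$$ -/

import Mathlib

open CategoryTheory Opposite TopologicalSpace
open scoped Manifold ContDiff

universe u

noncomputable section

namespace Orientifold

/-! ### Involutions and smooth circle-valued functions -/

/-- A smooth involution `τ` of the manifold `M`; the pair `(M, τ)` is an orientifold. -/
structure SmoothInvolution {E : Type*} [NormedAddCommGroup E] [NormedSpace ℝ E] {H : Type*}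
    [TopologicalSpace H] (I : ModelWithCorners ℝ E H) (M : Type u) [TopologicalSpace M]
    [ChartedSpace H M] where
  toFun : M → M
  smooth : ContMDiff I I ∞ toFun
  involutive : Function.Involutive toFun

section Sections

variable {E : Type*} [NormedAddCommGroup E] [NormedSpace ℝ E] {H : Type*}
  [TopologicalSpace H] {I : ModelWithCorners ℝ E H} {M : Type u} [TopologicalSpace M]
  [ChartedSpace H M]
variable {E' : Type*} [NormedAddCommGroup E'] [NormedSpace ℝ E'] {H' : Type*}
  [TopologicalSpace H'] {J : ModelWithCorners ℝ E' H'} {N : Type u} [TopologicalSpace N]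
  [ChartedSpace H' N]

variable (I) in
/-- The group of smooth functions `W → U(1)` on the open set `W`, written additively. -/
abbrev Sec (W : Opens M) : Type u := Additive C^∞⟮I, W; 𝓡 1, Circle⟯

/-- The value of a smooth function at a point (in `U(1)` written additively). -/
def Sec.val {W : Opens M} (s : Sec I W) (x : M) (hx : x ∈ W) : Additive Circle :=
  Additive.ofMul (s.toMul ⟨x, hx⟩)

theorem Sec.ext {W : Opens M} {s t : Sec I W} (h : ∀ x hx, s.val x hx = t.val x hx) : s = t :=
  Additive.toMul.injective (ContMDiffMap.ext fun x => Additive.ofMul.injective (h x.1 x.2))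

@[simp] theorem Sec.val_add {W : Opens M} (s t : Sec I W) (x : M) (hx : x ∈ W) :
    (s + t).val x hx = s.val x hx + t.val x hx := rfl

@[simp] theorem Sec.val_neg {W : Opens M} (s : Sec I W) (x : M) (hx : x ∈ W) :
    (-s).val x hx = -s.val x hx := rfl

@[simp] theorem Sec.val_zero {W : Opens M} (x : M) (hx : x ∈ W) :
    (0 : Sec I W).val x hx = 0 := rfl

theorem Sec.val_sum {ι : Type*} (S : Finset ι) {W : Opens M} (s : ι → Sec I W) (x : M)
    (hx : x ∈ W) : (∑ i ∈ S, s i).val x hx = ∑ i ∈ S, (s i).val x hx :=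
  map_sum (AddMonoidHom.mk' (fun s : Sec I W => s.val x hx) fun _ _ => rfl) s S

/-- Pullback of smooth functions along a smooth map `φ` with `φ(W) ⊆ V`. -/
def Sec.pull (φ : M → N) (hφ : ContMDiff I J ∞ φ) {W : Opens M} {V : Opens N}
    (h : ∀ x ∈ W, φ x ∈ V) : Sec J V →+ Sec I W where
  toFun s := Additive.ofMul ⟨fun x => s.toMul ⟨φ x.1, h x.1 x.2⟩,
    ContMDiff.comp s.toMul.contMDiff
      ((ContMDiff.subtypeVal_comp_iff V fun x : W => (⟨φ x.1, h x.1 x.2⟩ : V)).1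
        (hφ.comp contMDiff_subtype_val))⟩
  map_zero' := rfl
  map_add' _ _ := rfl

@[simp] theorem Sec.val_pull (φ : M → N) (hφ : ContMDiff I J ∞ φ) {W : Opens M} {V : Opens N}
    (h : ∀ x ∈ W, φ x ∈ V) (s : Sec J V) (x : M) (hx : x ∈ W) :
    (Sec.pull φ hφ h s).val x hx = s.val (φ x) (h x hx) := rfl

/-- A function on `V` which is locally given by smooth sections is a smooth section. -/
theorem Sec.exists_of_local {V : Opens M} (f : ∀ x ∈ V, Additive Circle)
    (h : ∀ x (_ : x ∈ V), ∃ (W : Opens M) (s : Sec I W), x ∈ W ∧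
      ∀ y (hy : y ∈ V) (hW : y ∈ W), f y hy = s.val y hW) :
    ∃ s : Sec I V, ∀ x hx, s.val x hx = f x hx := by
  refine ⟨Additive.ofMul ⟨fun x => (f x.1 x.2).toMul, ?_⟩, fun _ _ => rfl⟩
  intro x
  obtain ⟨W, s, hx, hs⟩ := h x.1 x.2
  let W' : Opens M := V ⊓ W
  let s' : Sec I W' := Sec.pull id contMDiff_id (fun y (hy : y ∈ V ⊓ W) => hy.2) s
  have key : ContMDiffAt I (𝓡 1) ∞ ((fun x : V => (f x.1 x.2).toMul) ∘
      Opens.inclusion (inf_le_left : W' ≤ V)) ⟨x.1, x.2, hx⟩ := by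
    have e : ((fun x : V => (f x.1 x.2).toMul) ∘ Opens.inclusion (inf_le_left : W' ≤ V)) =
        s'.toMul := by
      funext y
      exact congrArg Additive.toMul (hs y.1 y.2.1 y.2.2)
    rw [e]
    exact s'.toMul.contMDiff _
  exact ((contDiffWithinAt_localInvariantProp ∞).liftPropAt_iff_comp_inclusion
    (inf_le_left : W' ≤ V) _ _).2 key

/-- The action of `g ∈ ℤ/2` on `U(1)` (or on functions with values in `U(1)`, written additively)
attached to `ε ∈ ℤ/2`: trivial for `ε = 0`, and by complex conjugation `z ↦ z̄ = z⁻¹`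
for `ε = 1`. -/
def conj (ε g : ZMod 2) (A : Type*) [AddCommGroup A] : A →+ A :=
  if ε * g = 0 then AddMonoidHom.id A else -AddMonoidHom.id A


theorem conj_map (ε g : ZMod 2) {A B : Type*} [AddCommGroup A] [AddCommGroup B] (f : A →+ B)
    (a : A) : f (conj ε g A a) = conj ε g B (f a) := by
  unfold conj; split_ifs <;> simp

theorem conj_conj (ε g h : ZMod 2) {A : Type*} [AddCommGroup A] (a : A) :
    conj ε g A (conj ε h A a) = conj ε (g + h) A a := by
  have key : ∀ x : ZMod 2, x = 0 ∨ x = 1 := by decide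
  rcases key ε with rfl | rfl <;> rcases key g with rfl | rfl <;> rcases key h with rfl | rfl <;>
    simp [conj, CharTwo.add_self_eq_zero]

@[simp] theorem conj_zero (ε : ZMod 2) {A : Type*} [AddCommGroup A] (a : A) :
    conj ε 0 A a = a := by
  simp [conj]

@[simp] theorem Sec.val_conj {W : Opens M} (ε g : ZMod 2) (s : Sec I W) (x : M) (hx : x ∈ W) :
    (conj ε g _ s).val x hx = conj ε g _ (s.val x hx) := by
  unfold conj; split_ifs <;> rfl

theorem Sec.val_congr {W : Opens M} (s : Sec I W) {x y : M} (h : x = y) (hx : x ∈ W) :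
    s.val x hx = s.val y (h ▸ hx) := by
  subst h; rfl

/-! ### The site of equivariant sheaves -/

namespace SmoothInvolution

variable (τ : SmoothInvolution I M)

/-- The action of `ℤ/2` on `M`: `0` acts as the identity and `1` as the involution. -/
def act (g : ZMod 2) : M → M := if g = 0 then id else τ.toFun

@[simp] theorem act_zero (x : M) : τ.act 0 x = x := rfl

theorem act_one (x : M) : τ.act 1 x = τ.toFun x := rfl

theorem act_add (g h : ZMod 2) (x : M) : τ.act (g + h) x = τ.act g (τ.act h x) := by
  fin_cases g <;> fin_cases h <;> try rfl
  exact (τ.involutive x).symm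

@[simp] theorem act_act_self (g : ZMod 2) (x : M) : τ.act g (τ.act g x) = x := by
  rw [← act_add, CharTwo.add_self_eq_zero, act_zero]

theorem smooth_act (g : ZMod 2) : ContMDiff I I ∞ (τ.act g) := by
  unfold act; split_ifs
  exacts [contMDiff_id, τ.smooth]

/-- The open set `g⁻¹ U = g U`. -/
def translate (g : ZMod 2) (U : Opens M) : Opens M :=
  ⟨τ.act g ⁻¹' U, U.isOpen.preimage (τ.smooth_act g).continuous⟩

theorem mem_translate {g : ZMod 2} {U : Opens M} {x : M} :
    x ∈ τ.translate g U ↔ τ.act g x ∈ U := Iff.rfl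

/-- The open subsets of `M`, as objects of the site `τ.EqOpens` below. -/
structure EqOpens (τ : SmoothInvolution I M) : Type u where
  carrier : Opens M

/-- A morphism `U ⟶ V` is an element `g ∈ ℤ/2` with `g U ⊆ V`. -/
@[ext] structure EqOpens.Hom {τ : SmoothInvolution I M} (U V : τ.EqOpens) : Type u where
  elt : ZMod 2
  act_mem : ∀ x ∈ U.carrier, τ.act elt x ∈ V.carrier

/-- A presheaf on this category is the same as a presheaf `F` on `M` with isomorphisms
`F(gU) ≅ F(U)` for `g ∈ ℤ/2`, compatible with restrictions and with the group law. -/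
instance : SmallCategory τ.EqOpens where
  Hom U V := EqOpens.Hom U V
  id U := ⟨0, fun _ hx => hx⟩
  comp f g := ⟨g.elt + f.elt, fun x hx => by
    rw [act_add]; exact g.act_mem _ (f.act_mem _ hx)⟩
  id_comp f := EqOpens.Hom.ext (add_zero _)
  comp_id f := EqOpens.Hom.ext (zero_add _)
  assoc f g h := EqOpens.Hom.ext (add_assoc _ _ _).symm

variable {τ} in
@[ext] theorem EqOpens.hom_ext {U V : τ.EqOpens} {f g : U ⟶ V} (h : f.elt = g.elt) : f = g :=
  EqOpens.Hom.ext h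

@[simp] theorem EqOpens.id_elt (U : τ.EqOpens) : EqOpens.Hom.elt (𝟙 U) = 0 := rfl

@[simp] theorem EqOpens.comp_elt {U V W : τ.EqOpens} (f : U ⟶ V) (g : V ⟶ W) :
    (f ≫ g).elt = g.elt + f.elt := rfl

/-- A sieve covers `V` if the translates `g U ⊆ V` belonging to it cover `V`. Sheaves for this
topology are exactly the `ℤ/2`-equivariant sheaves on `(M, τ)`. -/
def topology : GrothendieckTopology τ.EqOpens where
  sieves V := {S | ∀ x ∈ V.carrier, ∃ (U : τ.EqOpens) (f : U ⟶ V), S f ∧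
    ∃ y ∈ U.carrier, τ.act f.elt y = x}
  top_mem' V x hx := ⟨V, 𝟙 V, trivial, x, hx, rfl⟩
  pullback_stable' V W S f hS y hy := by
    obtain ⟨U, g, hg, z, hz, hzy⟩ := hS _ (f.act_mem y hy)
    have e : τ.act (f.elt + g.elt) z = y := by
      rw [act_add, hzy, act_act_self]
    refine ⟨⟨U.carrier ⊓ τ.translate (f.elt + g.elt) W.carrier⟩,
      ⟨f.elt + g.elt, fun x hx => hx.2⟩, ?_, z, ⟨hz, ?_⟩, e⟩
    · have : (⟨0, fun x hx => hx.1⟩ : EqOpens.Hom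
          (⟨U.carrier ⊓ τ.translate (f.elt + g.elt) W.carrier⟩ : τ.EqOpens) U) ≫ g =
          (⟨f.elt + g.elt, fun x hx => hx.2⟩ : EqOpens.Hom
          (⟨U.carrier ⊓ τ.translate (f.elt + g.elt) W.carrier⟩ : τ.EqOpens) W) ≫ f := by
        ext
        change g.elt + 0 = f.elt + (f.elt + g.elt)
        rw [← add_assoc, CharTwo.add_self_eq_zero, zero_add, add_zero]
      change S _
      rw [← this]
      exact S.downward_closed hg _
    · change τ.act _ z ∈ W.carrier
      rw [e]; exact hy
  transitive' V S hS R hR x hx := by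
    obtain ⟨U, f, hf, y, hy, rfl⟩ := hS x hx
    obtain ⟨W, g, hg, z, hz, rfl⟩ := hR hf y hy
    exact ⟨W, g ≫ f, hg, z, hz, τ.act_add _ _ _⟩

theorem mem_topology {V : τ.EqOpens} {S : Sieve V} :
    S ∈ τ.topology V ↔ ∀ x ∈ V.carrier, ∃ (U : τ.EqOpens) (f : U ⟶ V), S f ∧
      ∃ y ∈ U.carrier, τ.act f.elt y = x := Iff.rfl

/-- The category of `ℤ/2`-equivariant sheaves of abelian groups on `(M, τ)`. -/
abbrev EqSheaf := Sheaf τ.topology AddCommGrpCat.{u}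

/-! ### The equivariant sheaves of smooth circle-valued functions -/

/-- Restriction of `U(1)`-valued functions along `g U ⊆ V`: `f ↦ conj_ε(g) ∘ f ∘ g`. -/
def unitaryMap (ε : ZMod 2) {U V : τ.EqOpens} (f : U ⟶ V) : Sec I V.carrier →+ Sec I U.carrier :=
  (conj ε f.elt _).comp (Sec.pull (τ.act f.elt) (τ.smooth_act _) f.act_mem)

theorem unitaryMap_val (ε : ZMod 2) {U V : τ.EqOpens} (f : U ⟶ V)
    (s : Sec I V.carrier) (x : M) (hx : x ∈ U.carrier) :
    (τ.unitaryMap ε f s).val x hx =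
      conj ε f.elt _ (s.val (τ.act f.elt x) (f.act_mem x hx)) :=
  Sec.val_conj _ _ _ _ _

/-- The equivariant presheaf of smooth `U(1)`-valued functions. -/
def unitaryPresheaf (ε : ZMod 2) : τ.EqOpensᵒᵖ ⥤ AddCommGrpCat.{u} where
  obj U := AddCommGrpCat.of (Sec I U.unop.carrier)
  map f := AddCommGrpCat.ofHom (τ.unitaryMap ε f.unop)
  map_id U := by
    refine AddCommGrpCat.hom_ext (AddMonoidHom.ext fun s => Sec.ext fun x hx => ?_)
    exact (Sec.val_conj _ _ _ _ _).trans (conj_zero _ _)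
  map_comp {U V W} f g := by
    refine AddCommGrpCat.hom_ext (AddMonoidHom.ext fun s => Sec.ext fun x hx => ?_)
    refine (Sec.val_conj _ _ _ _ _).trans (Eq.trans ?_ (Sec.val_conj _ _ _ _ _).symm)
    refine Eq.trans ?_ (congrArg _ (Sec.val_conj _ _ _ _ _).symm)
    refine Eq.trans ?_ (conj_conj _ _ _ _).symm
    refine (congrArg _ (Sec.val_congr s (τ.act_add _ _ _) _)).trans ?_
    congr 2
    exact add_comm _ _

theorem unitaryPresheaf_map_val (ε : ZMod 2) {U V : τ.EqOpens} (f : U ⟶ V)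
    (s : Sec I V.carrier) (x : M) (hx : x ∈ U.carrier) :
    Sec.val (((τ.unitaryPresheaf ε).map f.op).hom s) x hx =
      conj ε f.elt _ (s.val (τ.act f.elt x) (f.act_mem x hx)) :=
  Sec.val_conj _ _ _ _ _

theorem isSheaf_unitaryPresheaf (ε : ZMod 2) :
    Presheaf.IsSheaf τ.topology (τ.unitaryPresheaf ε) := by
  rw [Presheaf.isSheaf_iff_isSheaf_forget _ _ (forget AddCommGrpCat.{u}),
    isSheaf_iff_isSheaf_of_type]
  intro V S hS a ha
  -- the value of the glued section at `τ.act f.elt y`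
  let v : ∀ (U : τ.EqOpens) (f : U ⟶ V) (_ : S f) (y : M) (_ : y ∈ U.carrier), Additive Circle :=
    fun U f hf y hy => conj ε f.elt _ (Sec.val (a f hf : Sec I U.carrier) y hy)
  have hv : ∀ (U : τ.EqOpens) (f : U ⟶ V) (hf : S f) (y : M) (hy : y ∈ U.carrier)
      (U' : τ.EqOpens) (f' : U' ⟶ V) (hf' : S f') (y' : M) (hy' : y' ∈ U'.carrier),
      τ.act f.elt y = τ.act f'.elt y' → v U f hf y hy = v U' f' hf' y' hy' := by
    intro U f hf y hy U' f' hf' y' hy' e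
    have e' : τ.act (f'.elt + f.elt) y = y' := by
      rw [act_add, e, act_act_self]
    let W : τ.EqOpens := ⟨U.carrier ⊓ τ.translate (f'.elt + f.elt) U'.carrier⟩
    have hyW : y ∈ W.carrier := ⟨hy, by change τ.act _ y ∈ U'.carrier; rw [e']; exact hy'⟩
    let p : W ⟶ U := ⟨0, fun x hx => hx.1⟩
    let q : W ⟶ U' := ⟨f'.elt + f.elt, fun x hx => hx.2⟩
    have hpq : p ≫ f = q ≫ f' := by
      ext
      change f.elt + 0 = f'.elt + (f'.elt + f.elt)
      rw [← add_assoc, CharTwo.add_self_eq_zero, zero_add, add_zero]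
    have h := ha p q hf hf' hpq
    have h' := congrArg (fun s : Sec I W.carrier => s.val y hyW) h
    have h1 := τ.unitaryPresheaf_map_val ε p (a f hf) y hyW
    have h2 := τ.unitaryPresheaf_map_val ε q (a f' hf') y hyW
    have h3 := h1.symm.trans (h'.trans h2)
    have h4 : Sec.val (a f hf : Sec I U.carrier) y hy =
        conj ε (f'.elt + f.elt) _ (Sec.val (a f' hf' : Sec I U'.carrier) y' hy') := by
      refine (conj_zero ε _).symm.trans (h3.trans (congrArg _ ?_))
      exact Sec.val_congr (a f' hf' : Sec I U'.carrier) e' _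
    change conj ε f.elt _ _ = conj ε f'.elt _ _
    rw [h4, conj_conj, add_comm f'.elt, ← add_assoc, CharTwo.add_self_eq_zero, zero_add]
  choose U f hf y hy hyx using hS
  obtain ⟨s, hs⟩ := Sec.exists_of_local (I := I) (V := V.carrier)
    (fun x hx => v (U x hx) (f x hx) (hf x hx) (y x hx) (hy x hx)) (by
      intro x hx
      refine ⟨τ.translate (f x hx).elt (U x hx).carrier,
        conj ε (f x hx).elt _ (Sec.pull (τ.act (f x hx).elt) (τ.smooth_act _)
          (fun z hz => hz) (a (f x hx) (hf x hx) : Sec I (U x hx).carrier)), ?_, ?_⟩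
      · change τ.act (f x hx).elt x ∈ (U x hx).carrier
        have := congrArg (τ.act (f x hx).elt) (hyx x hx)
        rw [act_act_self] at this
        rw [← this]; exact hy x hx
      · intro z hz hz'
        refine Eq.trans ?_ (Sec.val_conj _ _ _ _ _).symm
        exact hv _ _ _ _ _ _ (f x hx) (hf x hx) (τ.act (f x hx).elt z) hz'
          ((hyx z hz).trans (act_act_self _ _ _).symm))
  refine ⟨s, ?_, ?_⟩
  · intro W g hg
    refine Sec.ext fun x hx => ?_
    refine (τ.unitaryPresheaf_map_val ε g s x hx).trans ?_
    rw [hs, hv _ _ _ _ _ W g hg x hx (hyx _ _), conj_conj, CharTwo.add_self_eq_zero, conj_zero]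
  · intro t ht
    refine Sec.ext fun x hx => ?_
    rw [hs]
    have h := congrArg (fun s : Sec I (U x hx).carrier => s.val (y x hx) (hy x hx))
      (ht (f x hx) (hf x hx))
    have h1 := τ.unitaryPresheaf_map_val ε (f x hx) t (y x hx) (hy x hx)
    have h2 := h1.symm.trans h
    change _ = conj ε _ _ _
    refine Eq.trans ?_ (congrArg _ h2)
    rw [conj_conj, CharTwo.add_self_eq_zero, conj_zero]
    exact (Sec.val_congr t (hyx x hx) _).symm

/-- The equivariant sheaf `𝒰^ε` of smooth `U(1)`-valued functions on `M`, where `ℤ/2` acts on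
`U(1)` trivially for `ε = 0` and by complex conjugation for `ε = 1`. -/
def unitary (ε : ZMod 2) : τ.EqSheaf := ⟨τ.unitaryPresheaf ε, τ.isSheaf_unitaryPresheaf ε⟩

/-- A section over `U` of the equivariant sheaf induced from the non-equivariant sheaf `𝒰(1)`:
a pair of smooth functions, one on `U` and one on `τ U`. -/
abbrev InducedSec (U : Opens M) : Type u := ∀ h : ZMod 2, Sec I (τ.translate h U)

variable {τ} in
theorem InducedSec.val_congr {U : Opens M} (a : τ.InducedSec U) {h k : ZMod 2} (e : h = k)
    {x : M} (hx : x ∈ τ.translate h U) :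
    (a h).val x hx = (a k).val x (e ▸ hx) := by
  subst e; rfl

theorem InducedSec.act_mem {U V : τ.EqOpens} (f : U ⟶ V) (h : ZMod 2) (x : M)
    (hx : x ∈ τ.translate h U.carrier) : id x ∈ τ.translate (f.elt + h) V.carrier := by
  change τ.act (f.elt + h) x ∈ V.carrier
  rw [act_add]
  exact f.act_mem _ hx

/-- Restriction of pairs along `g U ⊆ V`: restrict the two functions, and swap them if `g = 1`. -/
def inducedMap {U V : τ.EqOpens} (f : U ⟶ V) :
    τ.InducedSec V.carrier →+ τ.InducedSec U.carrier where
  toFun a h := Sec.pull id contMDiff_id (InducedSec.act_mem τ f h) (a (f.elt + h))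
  map_zero' := rfl
  map_add' _ _ := rfl

/-- The presheaf underlying the induced sheaf. -/
def inducedPresheaf : τ.EqOpensᵒᵖ ⥤ AddCommGrpCat.{u} where
  obj U := AddCommGrpCat.of (τ.InducedSec U.unop.carrier)
  map f := AddCommGrpCat.ofHom (τ.inducedMap f.unop)
  map_id U := by
    refine AddCommGrpCat.hom_ext (AddMonoidHom.ext fun a => funext fun h => Sec.ext fun x hx => ?_)
    exact InducedSec.val_congr (show τ.InducedSec U.unop.carrier from a) (zero_add h) _
  map_comp {U V W} f g := by
    refine AddCommGrpCat.hom_ext (AddMonoidHom.ext fun a => funext fun h => Sec.ext fun x hx => ?_)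
    exact InducedSec.val_congr (show τ.InducedSec U.unop.carrier from a)
      (add_assoc f.unop.elt g.unop.elt h) _

theorem inducedPresheaf_map_val {U V : τ.EqOpens} (f : U ⟶ V)
    (a : τ.InducedSec V.carrier) (h : ZMod 2) (x : M) (hx : x ∈ τ.translate h U.carrier) :
    Sec.val ((show τ.InducedSec U.carrier from (τ.inducedPresheaf.map f.op).hom a) h) x hx =
      (a (f.elt + h)).val x (InducedSec.act_mem τ f h x hx) := rfl

theorem isSheaf_inducedPresheaf : Presheaf.IsSheaf τ.topology τ.inducedPresheaf := by
  rw [Presheaf.isSheaf_iff_isSheaf_forget _ _ (forget AddCommGrpCat.{u}),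
    isSheaf_iff_isSheaf_of_type]
  intro V S hS a ha
  let v : ∀ (U : τ.EqOpens) (f : U ⟶ V) (_ : S f) (h : ZMod 2) (x : M)
      (_ : x ∈ τ.translate (f.elt + h) U.carrier), Additive Circle :=
    fun U f hf h x hx =>
      Sec.val ((show τ.InducedSec U.carrier from a f hf) (f.elt + h)) x hx
  have hv : ∀ (U : τ.EqOpens) (f : U ⟶ V) (hf : S f) (U' : τ.EqOpens) (f' : U' ⟶ V) (hf' : S f')
      (h : ZMod 2) (x : M) (hx : x ∈ τ.translate (f.elt + h) U.carrier)
      (hx' : x ∈ τ.translate (f'.elt + h) U'.carrier), v U f hf h x hx = v U' f' hf' h x hx' := by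
    intro U f hf U' f' hf' h x hx hx'
    let W : τ.EqOpens := ⟨U.carrier ⊓ τ.translate (f'.elt + f.elt) U'.carrier⟩
    have hk : f'.elt + f.elt + (f.elt + h) = f'.elt + h := by
      rw [add_assoc, ← add_assoc f.elt, CharTwo.add_self_eq_zero, zero_add]
    have hxW : x ∈ τ.translate (f.elt + h) W.carrier := by
      refine ⟨hx, ?_⟩
      change τ.act _ (τ.act _ x) ∈ U'.carrier
      rw [← act_add, hk]; exact hx'
    let p : W ⟶ U := ⟨0, fun x hx => hx.1⟩
    let q : W ⟶ U' := ⟨f'.elt + f.elt, fun x hx => hx.2⟩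
    have hpq : p ≫ f = q ≫ f' := by
      ext
      change f.elt + 0 = f'.elt + (f'.elt + f.elt)
      rw [← add_assoc, CharTwo.add_self_eq_zero, zero_add, add_zero]
    have h' := congrArg (fun s : τ.InducedSec W.carrier => (s (f.elt + h)).val x hxW)
      (ha p q hf hf' hpq)
    refine (InducedSec.val_congr (show τ.InducedSec U.carrier from a f hf)
      (zero_add (f.elt + h)).symm hx).trans (Eq.trans h' ?_)
    exact InducedSec.val_congr (show τ.InducedSec U'.carrier from a f' hf') hk _
  choose U f hf y hy hyx using hS
  have hmem : ∀ (h : ZMod 2) (x : M) (hx : τ.act h x ∈ V.carrier),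
      x ∈ τ.translate ((f _ hx).elt + h) (U _ hx).carrier := by
    intro h x hx
    change τ.act _ x ∈ (U _ hx).carrier
    have := congrArg (τ.act (f _ hx).elt) (hyx _ hx)
    rw [act_act_self] at this
    rw [act_add, ← this]
    exact hy _ hx
  have glue : ∀ h : ZMod 2, ∃ s : Sec I (τ.translate h V.carrier), ∀ x hx, s.val x hx =
      v (U (τ.act h x) hx) (f _ hx) (hf _ hx) h x (hmem h x hx) := by
    intro h
    refine Sec.exists_of_local (V := τ.translate h V.carrier)
      (fun x hx => v (U (τ.act h x) hx) (f _ hx) (hf _ hx) h x (hmem h x hx)) ?_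
    intro x hx
    exact ⟨τ.translate ((f _ hx).elt + h) (U _ hx).carrier,
      (show τ.InducedSec (U _ hx).carrier from a (f _ hx) (hf _ hx)) ((f _ hx).elt + h),
      hmem h x hx, fun z hz hz' => hv _ _ _ _ _ _ _ _ _ _⟩
  choose s hs using glue
  refine ⟨s, ?_, ?_⟩
  · intro W g hg
    refine funext fun h => Sec.ext fun x hx => ?_
    refine (τ.inducedPresheaf_map_val g s h x hx).trans ?_
    have hh : g.elt + (g.elt + h) = h := by
      rw [← add_assoc, CharTwo.add_self_eq_zero, zero_add]
    rw [hs, hv _ _ _ W g hg (g.elt + h) x _ (hh.symm ▸ hx)]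
    exact InducedSec.val_congr (show τ.InducedSec W.carrier from a g hg) hh _
  · intro t ht
    refine funext fun h => Sec.ext fun x hx => ?_
    rw [hs]
    have h1 := congrArg (fun s : τ.InducedSec (U _ hx).carrier =>
      (s ((f _ hx).elt + h)).val x (hmem h x hx)) (ht (f _ hx) (hf _ hx))
    refine Eq.trans ?_ h1
    have hh : ∀ k : ZMod 2, h = k + (k + h) := fun k => by
      rw [← add_assoc, CharTwo.add_self_eq_zero, zero_add]
    exact InducedSec.val_congr (U := V.carrier) t (hh (f _ hx).elt) hx

/-- The equivariant sheaf induced from the (non-equivariant) sheaf `𝒰(1)` of smooth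
`U(1)`-valued functions on `M`, i.e. its direct image under the map from the site of open subsets
of `M` to the equivariant site; its equivariant cohomology is `H^*(M, 𝒰(1))`. -/
def induced : τ.EqSheaf := ⟨τ.inducedPresheaf, τ.isSheaf_inducedPresheaf⟩

theorem act_mem_translate {U : Opens M} (h : ZMod 2) (x : M) (hx : x ∈ U) :
    τ.act h x ∈ τ.translate h U := by
  change τ.act h (τ.act h x) ∈ U
  rwa [act_act_self]

/-- The inclusion `𝒰^ε(U) → (ind 𝒰(1))(U)`: a function `f` on `U` is sent to the pair consisting
of `f` on `U` and `conj_ε ∘ f ∘ τ` on `τ U`. -/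
def toInducedHom (ε : ZMod 2) (U : Opens M) : Sec I U →+ τ.InducedSec U where
  toFun s h := conj ε h _ (Sec.pull (τ.act h) (τ.smooth_act h)
    (fun x (hx : x ∈ τ.translate h U) => hx) s)
  map_zero' := funext fun h => by simp only [map_zero]; rfl
  map_add' s t := funext fun h => by simp only [map_add]; rfl

theorem toInducedHom_val (ε : ZMod 2) (U : Opens M) (s : Sec I U) (h : ZMod 2) (x : M)
    (hx : x ∈ τ.translate h U) :
    (τ.toInducedHom ε U s h).val x hx = conj ε h _ (s.val (τ.act h x) hx) :=
  Sec.val_conj _ _ _ _ _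

/-- The map `1 × τ^* : (ind 𝒰(1))(U) → 𝒰^ε(U)`, sending `(a, b)` to `a · (conj_ε ∘ b ∘ τ)`. -/
def normHom (ε : ZMod 2) (U : Opens M) : τ.InducedSec U →+ Sec I U where
  toFun a := ∑ h : ZMod 2, conj ε h (Sec I U)
    (Sec.pull (τ.act h) (τ.smooth_act h) (τ.act_mem_translate h) (a h))
  map_zero' := by simp only [Pi.zero_apply, map_zero, Finset.sum_const_zero]
  map_add' a b := by simp only [Pi.add_apply, map_add, Finset.sum_add_distrib]

theorem normHom_val (ε : ZMod 2) (U : Opens M) (a : τ.InducedSec U) (x : M) (hx : x ∈ U) :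
    (τ.normHom ε U a).val x hx =
      ∑ h : ZMod 2, conj ε h _ ((a h).val (τ.act h x) (τ.act_mem_translate h x hx)) := by
  change Sec.val (∑ h : ZMod 2, conj ε h (Sec I U)
    (Sec.pull (τ.act h) (τ.smooth_act h) (τ.act_mem_translate h) (a h))) x hx = _
  rw [Sec.val_sum]
  refine Finset.sum_congr rfl fun h _ => ?_
  exact Sec.val_conj _ _ _ _ _

theorem inducedMap_toInducedHom (ε : ZMod 2) {U V : τ.EqOpens} (f : U ⟶ V) (s : Sec I V.carrier) :
    τ.toInducedHom ε U.carrier (τ.unitaryMap ε f s) =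
      τ.inducedMap f (τ.toInducedHom ε V.carrier s) := by
  refine funext fun h => Sec.ext fun x hx => ?_
  refine (τ.toInducedHom_val ε _ _ _ _ _).trans
    (Eq.trans ?_ (τ.toInducedHom_val ε _ s (f.elt + h) x _).symm)
  refine (congrArg _ (τ.unitaryMap_val ε f s _ _)).trans ?_
  rw [conj_conj, add_comm h]
  exact congrArg _ (Sec.val_congr s (τ.act_add _ _ _).symm _)

theorem normHom_inducedMap (ε : ZMod 2) {U V : τ.EqOpens} (f : U ⟶ V)
    (a : τ.InducedSec V.carrier) :
    τ.normHom ε U.carrier (τ.inducedMap f a) = τ.unitaryMap ε f (τ.normHom ε V.carrier a) := by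
  refine Sec.ext fun x hx => ?_
  rw [normHom_val, unitaryMap_val, normHom_val, map_sum]
  refine Fintype.sum_equiv (Equiv.addLeft f.elt) _ _ fun h => ?_
  rw [conj_conj, Equiv.coe_addLeft]
  have hh : f.elt + (f.elt + h) = h := by
    rw [← add_assoc, CharTwo.add_self_eq_zero, zero_add]
  have hx' : τ.act h x = τ.act (f.elt + h) (τ.act f.elt x) := by
    rw [add_comm, act_add, act_act_self]
  rw [hh]
  exact congrArg _ (Sec.val_congr (a (f.elt + h)) hx' _)

theorem normHom_toInducedHom (ε : ZMod 2) (U : Opens M) (s : Sec I U) :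
    τ.normHom (ε + 1) U (τ.toInducedHom ε U s) = 0 := by
  refine Sec.ext fun x hx => ?_
  rw [normHom_val, Sec.val_zero]
  have e : ∀ h : ZMod 2, (τ.toInducedHom ε U s h).val (τ.act h x)
      (τ.act_mem_translate h x hx) = conj ε h _ (s.val x hx) := by
    intro h
    rw [toInducedHom_val]
    exact congrArg _ (Sec.val_congr s (τ.act_act_self h x) _)
  simp only [e]
  have key : ∀ x : ZMod 2, x = 0 ∨ x = 1 := by decide
  have hs : ∀ F : ZMod 2 → Additive Circle, ∑ h, F h = F 0 + F 1 := fun F => Fin.sum_univ_two F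
  rw [hs]
  rcases key ε with rfl | rfl <;> simp [conj, CharTwo.add_self_eq_zero]

theorem toInducedHom_injective (ε : ZMod 2) (U : Opens M) :
    Function.Injective (τ.toInducedHom ε U) := by
  refine (injective_iff_map_eq_zero _).2 fun s hs => Sec.ext fun x hx => ?_
  have h := τ.toInducedHom_val ε U s 0 x hx
  rw [hs, conj_zero] at h
  exact h.symm

theorem normHom_surjective (ε : ZMod 2) (U : Opens M) :
    Function.Surjective (τ.normHom ε U) := by
  intro s
  refine ⟨Pi.single 0 (Sec.pull id contMDiff_id (fun x (hx : x ∈ τ.translate 0 U) => hx) s),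
    Sec.ext fun x hx => ?_⟩
  have hs : ∀ F : ZMod 2 → Additive Circle, ∑ h, F h = F 0 + F 1 := fun F => Fin.sum_univ_two F
  rw [normHom_val, hs, conj_zero, Pi.single_eq_same, Pi.single_eq_of_ne one_ne_zero, Sec.val_zero,
    map_zero, add_zero]
  rfl

/-- The underlying function on `U` of a pair of functions. -/
def fstHom (U : Opens M) : τ.InducedSec U →+ Sec I U where
  toFun a := Sec.pull id contMDiff_id (fun _ hx => hx) (a 0)
  map_zero' := rfl
  map_add' _ _ := rfl

theorem toInducedHom_fstHom (ε : ZMod 2) (U : Opens M) (a : τ.InducedSec U)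
    (ha : τ.normHom (ε + 1) U a = 0) : τ.toInducedHom ε U (τ.fstHom U a) = a := by
  have hs : ∀ F : ZMod 2 → Additive Circle, ∑ h, F h = F 0 + F 1 := fun F => Fin.sum_univ_two F
  have key : ∀ x : ZMod 2, x = 0 ∨ x = 1 := by decide
  refine funext fun h => Sec.ext fun x hx => ?_
  rw [toInducedHom_val]
  change conj ε h _ ((a 0).val (τ.act h x) hx) = _
  rcases key h with rfl | rfl
  · rw [conj_zero]; rfl
  · change τ.act 1 x ∈ U at hx
    have h1 := τ.normHom_val (ε + 1) U a (τ.act 1 x) hx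
    have h2 : (a 1).val (τ.act 1 (τ.act 1 x)) (τ.act_mem_translate 1 _ hx) = (a 1).val x hx :=
      Sec.val_congr _ (τ.act_act_self 1 x) _
    rw [ha, hs, Sec.val_zero, conj_zero, h2] at h1
    have h3 : (a 0).val (τ.act 0 (τ.act 1 x)) (τ.act_mem_translate 0 _ hx) =
      (a 0).val (τ.act 1 x) hx := rfl
    rw [h3] at h1
    have h4 := eq_neg_of_add_eq_zero_left h1.symm
    rw [h4]
    rcases key ε with rfl | rfl <;> simp [conj, CharTwo.add_self_eq_zero]

/-- The inclusion of equivariant sheaves `𝒰^ε ⟶ ind 𝒰(1)`; on equivariant cohomology it induces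
the map forgetting the equivariance. -/
def toInduced (ε : ZMod 2) : τ.unitary ε ⟶ τ.induced where
  hom :=
    { app := fun U => AddCommGrpCat.ofHom (τ.toInducedHom ε U.unop.carrier)
      naturality := fun _ _ f => AddCommGrpCat.hom_ext (AddMonoidHom.ext fun s =>
        τ.inducedMap_toInducedHom ε f.unop s) }

/-- The morphism of equivariant sheaves `1 × τ^* : ind 𝒰(1) ⟶ 𝒰^ε`. -/
def norm (ε : ZMod 2) : τ.induced ⟶ τ.unitary ε where
  hom :=
    { app := fun U => AddCommGrpCat.ofHom (τ.normHom ε U.unop.carrier)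
      naturality := fun _ _ f => AddCommGrpCat.hom_ext (AddMonoidHom.ext fun a =>
        τ.normHom_inducedMap ε f.unop a) }

theorem toInduced_norm {ε ε' : ZMod 2} (h : ε' = ε + 1) : τ.toInduced ε ≫ τ.norm ε' = 0 := by
  subst h
  exact Sheaf.hom_ext (NatTrans.ext (funext fun U => AddCommGrpCat.hom_ext
    (AddMonoidHom.ext fun s => τ.normHom_toInducedHom ε U.unop.carrier s)))

/-- The sequence `0 ⟶ 𝒰^ε ⟶ ind 𝒰(1) ⟶ 𝒰^{ε+1} ⟶ 0` of equivariant sheaves. -/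
def shortComplex {ε ε' : ZMod 2} (h : ε' = ε + 1) : ShortComplex τ.EqSheaf :=
  ShortComplex.mk (τ.toInduced ε) (τ.norm ε') (τ.toInduced_norm h)

theorem shortComplex_shortExact {ε ε' : ZMod 2} (h : ε' = ε + 1) :
    (τ.shortComplex h).ShortExact := by
  subst h
  have hmono : Mono (τ.toInduced ε) := by
    have : Mono ((sheafToPresheaf _ _).map (τ.toInduced ε)) := by
      rw [NatTrans.mono_iff_mono_app]
      intro U
      rw [AddCommGrpCat.mono_iff_injective]
      exact τ.toInducedHom_injective ε U.unop.carrier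
    exact (sheafToPresheaf _ _).mono_of_mono_map this
  have hepi : Epi (τ.norm (ε + 1)) := by
    have : Sheaf.IsLocallySurjective (τ.norm (ε + 1)) :=
      Presheaf.isLocallySurjective_of_surjective _ _ fun U =>
        τ.normHom_surjective (ε + 1) U.unop.carrier
    infer_instance
  have hker : Limits.IsLimit (Limits.KernelFork.ofι (τ.toInduced ε) (τ.toInduced_norm rfl)) := by
    refine Limits.KernelFork.IsLimit.ofι' _ _ fun {K} k hk => ?_
    have hk' : ∀ (U : τ.EqOpensᵒᵖ) (s : K.obj.obj U),
        τ.toInducedHom ε U.unop.carrier (τ.fstHom U.unop.carrier ((k.hom.app U).hom s)) =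
          (k.hom.app U).hom s := fun U s =>
      τ.toInducedHom_fstHom ε _ _
        (congrArg (fun f : K ⟶ τ.unitary (ε + 1) => (f.hom.app U).hom s) hk)
    refine ⟨⟨⟨fun U => AddCommGrpCat.ofHom
      ((τ.fstHom U.unop.carrier).comp (k.hom.app U).hom), ?_⟩⟩, ?_⟩
    · intro U V f
      refine AddCommGrpCat.hom_ext (AddMonoidHom.ext fun s =>
        τ.toInducedHom_injective ε V.unop.carrier ?_)
      refine (hk' V _).trans (Eq.trans ?_ (τ.inducedMap_toInducedHom ε f.unop _).symm)
      refine Eq.trans ?_ (congrArg _ (hk' U s).symm)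
      exact congrArg (fun f => f.hom s) (k.hom.naturality f)
    · exact Sheaf.hom_ext (NatTrans.ext (funext fun U => AddCommGrpCat.hom_ext
        (AddMonoidHom.ext fun s => hk' U s)))
  exact { exact := ShortComplex.exact_of_f_is_kernel _ hker, mono_f := hmono, epi_g := hepi }

/-! ### Equivariant cohomology and the connecting homomorphisms -/

/-- The equivariant sheaf cohomology `H^n(M; ℤ/2, F)`: the derived functors of `F ↦ Γ(M, F)^{ℤ/2}`,
realised as the groups `Ext^n(ℤ, F)` in the category of equivariant sheaves. -/
abbrev Cohomology (F : τ.EqSheaf) (n : ℕ) : Type u := F.H n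

/-- The group `H^n(M; ℤ/2, 𝒰^{[n+1]})`, where `[k]` is the reduction of `k` mod `2`; for `n = p + 1` it classifies invariant `p`-gerbes. -/
abbrev GerbeClass (n : ℕ) : Type u := τ.Cohomology (τ.unitary ((n + 1 : ℕ) : ZMod 2)) n

/-- The connecting homomorphism `H^n(M; ℤ/2, 𝒰^{ε+1}) → H^{n+1}(M; ℤ/2, 𝒰^ε)` in the long exact
cohomology sequence
`⋯ → H^n(M; ℤ/2, 𝒰^ε) → H^n(M, 𝒰(1)) → H^n(M; ℤ/2, 𝒰^{ε+1}) → H^{n+1}(M; ℤ/2, 𝒰^ε) → ⋯`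
of `0 ⟶ 𝒰^ε ⟶ ind 𝒰(1) ⟶ 𝒰^{ε+1} ⟶ 0`, whose second map is `1 × τ^*`; it is given by the Yoneda
product with the class of this extension. -/
def connecting {ε ε' : ZMod 2} (h : ε' = ε + 1) (n : ℕ) :
    τ.Cohomology (τ.unitary ε') n →+ τ.Cohomology (τ.unitary ε) (n + 1) :=
  (τ.shortComplex_shortExact h).extClass.postcomp _ rfl

theorem parity_succ (n : ℕ) : ((n + 1 : ℕ) : ZMod 2) = ((n + 1 + 1 : ℕ) : ZMod 2) + 1 := by
  rw [Nat.cast_add_one (n + 1), add_assoc, CharTwo.add_self_eq_zero, add_zero]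

/-- The connecting homomorphism
`∂_{n+1} : H^n(M; ℤ/2, 𝒰^{[n+1]}) → H^{n+1}(M; ℤ/2, 𝒰^{[n+2]})`. -/
def gerbeConnecting (n : ℕ) : τ.GerbeClass n →+ τ.GerbeClass (n + 1) :=
  τ.connecting (parity_succ n) n

end SmoothInvolution

/-! ### Pullback along equivariant maps -/

attribute [local instance] Limits.reflectsLimits_of_reflectsIsomorphisms in
theorem preservesFiniteLimits_sheafPullback {C D : Type u} [SmallCategory C] [SmallCategory D]
    (G : C ⥤ D) (K : GrothendieckTopology C) (L : GrothendieckTopology D)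
    [G.IsContinuous K L] [RepresentablyFlat G] :
    Limits.PreservesFiniteLimits (G.sheafPullback AddCommGrpCat.{u} K L) := by
  have : Limits.PreservesFiniteLimits (G.op.lan : (_ ⥤ _ ⥤ AddCommGrpCat.{u})) := inferInstance
  exact Functor.sheafPullbackConstruction.preservesFiniteLimits _ _ _ _

/-- A smooth equivariant map (morphism of Real manifolds) `(N, τ') → (M, τ)`. -/
structure EquivariantMap (τ' : SmoothInvolution J N) (τ : SmoothInvolution I M) where
  toFun : N → M
  smooth : ContMDiff J I ∞ toFun
  equivariant : ∀ x, toFun (τ'.toFun x) = τ.toFun (toFun x)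

namespace EquivariantMap

open SmoothInvolution

variable {τ' : SmoothInvolution J N} {τ : SmoothInvolution I M} (φ : EquivariantMap τ' τ)

theorem map_act (g : ZMod 2) (x : N) : φ.toFun (τ'.act g x) = τ.act g (φ.toFun x) := by
  unfold act; split_ifs
  exacts [rfl, φ.equivariant x]

/-- The preimage functor `U ↦ φ⁻¹(U)` between the equivariant sites. -/
def preimage : τ.EqOpens ⥤ τ'.EqOpens where
  obj U := ⟨⟨φ.toFun ⁻¹' U.carrier, U.carrier.isOpen.preimage φ.smooth.continuous⟩⟩
  map {U V} f := ⟨f.elt, fun x hx => by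
    change φ.toFun _ ∈ V.carrier
    rw [map_act]; exact f.act_mem _ hx⟩
  map_id _ := rfl
  map_comp _ _ := rfl

theorem coverPreserving : CoverPreserving τ.topology τ'.topology φ.preimage where
  cover_preserve := by
    intro V S hS x hx
    obtain ⟨U, f, hf, y, hy, hyx⟩ := hS (φ.toFun x) hx
    have e : τ.act f.elt (φ.toFun x) = y := by rw [← hyx, act_act_self]
    refine ⟨φ.preimage.obj U, φ.preimage.map f, Sieve.image_mem_functorPushforward _ _ hf,
      τ'.act f.elt x, ?_, act_act_self _ _ _⟩
    change φ.toFun _ ∈ U.carrier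
    rw [map_act, e]; exact hy

instance : RepresentablyFlat φ.preimage where
  cofiltered X :=
    { nonempty := ⟨StructuredArrow.mk (Y := (⟨⊤⟩ : τ.EqOpens)) (f := (⟨0, fun _ _ => trivial⟩ :
        EqOpens.Hom X (φ.preimage.obj ⟨⊤⟩)))⟩
      cone_objs := by
        intro A B
        let a : EqOpens.Hom X (φ.preimage.obj A.right) := A.hom
        let b : EqOpens.Hom X (φ.preimage.obj B.right) := B.hom
        let W : τ.EqOpens :=
          ⟨τ.translate a.elt A.right.carrier ⊓ τ.translate b.elt B.right.carrier⟩
        have hW : ∀ x ∈ X.carrier, τ'.act 0 x ∈ (φ.preimage.obj W).carrier := by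
          intro x hx
          refine ⟨?_, ?_⟩
          · have := a.act_mem x hx
            change φ.toFun _ ∈ A.right.carrier at this
            rw [map_act] at this
            exact this
          · have := b.act_mem x hx
            change φ.toFun _ ∈ B.right.carrier at this
            rw [map_act] at this
            exact this
        refine ⟨StructuredArrow.mk (Y := W) (f := (⟨0, hW⟩ : EqOpens.Hom X (φ.preimage.obj W))),
          StructuredArrow.homMk (⟨a.elt, fun x hx => hx.1⟩ : EqOpens.Hom W A.right) ?_,
          StructuredArrow.homMk (⟨b.elt, fun x hx => hx.2⟩ : EqOpens.Hom W B.right) ?_, trivial⟩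
        · exact EqOpens.hom_ext (add_zero _)
        · exact EqOpens.hom_ext (add_zero _)
      cone_maps := by
        intro A B f g
        refine ⟨A, 𝟙 A, ?_⟩
        have hf := congrArg EqOpens.Hom.elt (StructuredArrow.w f)
        have hg := congrArg EqOpens.Hom.elt (StructuredArrow.w g)
        have h : f = g := by
          refine StructuredArrow.hom_ext _ _ (EqOpens.hom_ext ?_)
          exact add_right_cancel (hf.trans hg.symm)
        rw [h] }

instance : φ.preimage.IsContinuous τ.topology τ'.topology :=
  Functor.isContinuous_iff_coverPreserving.2 φ.coverPreserving

/-- The inverse image functor `φ⁻¹` on equivariant sheaves. -/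
def inverseImage : τ.EqSheaf ⥤ τ'.EqSheaf :=
  φ.preimage.sheafPullback AddCommGrpCat.{u} τ.topology τ'.topology

/-- The direct image functor `φ_*` on equivariant sheaves. -/
abbrev directImage : τ'.EqSheaf ⥤ τ.EqSheaf :=
  φ.preimage.sheafPushforwardContinuous AddCommGrpCat.{u} τ.topology τ'.topology

/-- `φ⁻¹` is left adjoint to `φ_*`. -/
def adjunction : φ.inverseImage ⊣ φ.directImage :=
  φ.preimage.sheafAdjunctionContinuous AddCommGrpCat.{u} τ.topology τ'.topology

instance : Limits.PreservesFiniteLimits φ.inverseImage :=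
  preservesFiniteLimits_sheafPullback φ.preimage τ.topology τ'.topology

instance : Limits.PreservesFiniteColimits φ.inverseImage :=
  have : φ.inverseImage.IsLeftAdjoint := φ.adjunction.isLeftAdjoint
  inferInstance

instance : φ.inverseImage.Additive := Functor.additive_of_preserves_binary_products _

/-- Composition with `φ`, as a morphism `𝒰^ε ⟶ φ_* 𝒰^ε` of equivariant sheaves. -/
def compUnitary (ε : ZMod 2) : τ.unitary ε ⟶ φ.directImage.obj (τ'.unitary ε) where
  hom :=
    { app := fun U => AddCommGrpCat.ofHom
        (Sec.pull φ.toFun φ.smooth fun x (hx : x ∈ (φ.preimage.obj U.unop).carrier) => hx)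
      naturality := by
        intro U V f
        refine AddCommGrpCat.hom_ext (AddMonoidHom.ext fun s => Sec.ext fun x hx => ?_)
        refine (τ.unitaryMap_val ε f.unop s (φ.toFun x) hx).trans
          (Eq.trans ?_ (τ'.unitaryMap_val ε (φ.preimage.map f.unop) _ x hx).symm)
        exact congrArg _ (Sec.val_congr s (φ.map_act _ _).symm _) }

/-- The pullback morphism `φ⁻¹ 𝒰^ε ⟶ 𝒰^ε`. -/
def pullUnitary (ε : ZMod 2) : φ.inverseImage.obj (τ.unitary ε) ⟶ τ'.unitary ε :=
  (φ.adjunction.homEquiv _ _).symm (φ.compUnitary ε)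

/-- The inclusion of an open set in the preimage of all of `M`. -/
def toPreimageTop (U : τ'.EqOpens) : U ⟶ φ.preimage.obj ⟨⊤⟩ := ⟨0, fun _ _ => trivial⟩

/-- The unit `A ⟶ Γ(M, A_M) ⟶ Γ(N, φ⁻¹ A_M)`, where `A_M` is the constant sheaf. -/
def constSection (A : AddCommGrpCat.{u}) :
    A ⟶ (φ.inverseImage.obj ((constantSheaf τ.topology AddCommGrpCat.{u}).obj A)).obj.obj
      (op (φ.preimage.obj ⟨⊤⟩)) :=
  let a : A ⟶ ((constantSheaf τ.topology AddCommGrpCat.{u}).obj A).obj.obj (op ⟨⊤⟩) :=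
    ((sheafificationAdjunction τ.topology AddCommGrpCat.{u}).unit.app
      ((Functor.const τ.EqOpensᵒᵖ).obj A)).app (op ⟨⊤⟩)
  a ≫ (φ.adjunction.unit.app ((constantSheaf τ.topology AddCommGrpCat.{u}).obj A)).hom.app
    (op ⟨⊤⟩)

theorem constSection_map (A : AddCommGrpCat.{u}) (t : (⟨⊤⟩ : τ.EqOpens) ⟶ ⟨⊤⟩) :
    φ.constSection A ≫ (φ.inverseImage.obj
      ((constantSheaf τ.topology AddCommGrpCat.{u}).obj A)).obj.map (φ.preimage.map t).op =
      φ.constSection A := by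
  let Z := (constantSheaf τ.topology AddCommGrpCat.{u}).obj A
  let F := φ.inverseImage.obj Z
  let a : A ⟶ Z.obj.obj (op ⟨⊤⟩) :=
    ((sheafificationAdjunction τ.topology AddCommGrpCat.{u}).unit.app
      ((Functor.const τ.EqOpensᵒᵖ).obj A)).app (op ⟨⊤⟩)
  let b : Z.obj.obj (op ⟨⊤⟩) ⟶ F.obj.obj (op (φ.preimage.obj ⟨⊤⟩)) :=
    (φ.adjunction.unit.app Z).hom.app (op ⟨⊤⟩)
  have ha : a = a ≫ Z.obj.map t.op :=
    (Category.id_comp _).symm.trans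
      (((sheafificationAdjunction τ.topology AddCommGrpCat.{u}).unit.app
        ((Functor.const τ.EqOpensᵒᵖ).obj A)).naturality t.op)
  have hb : Z.obj.map t.op ≫ b = b ≫ F.obj.map (φ.preimage.map t).op :=
    (φ.adjunction.unit.app Z).hom.naturality t.op
  change (a ≫ b) ≫ F.obj.map (φ.preimage.map t).op = a ≫ b
  rw [Category.assoc, ← hb, ← Category.assoc, ← ha]

/-- The canonical map `A ⟶ φ⁻¹ A_M` of presheaves, where `A_M` is the constant sheaf. -/
def constPresheafMap (A : AddCommGrpCat.{u}) : (Functor.const τ'.EqOpensᵒᵖ).obj A ⟶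
    (φ.inverseImage.obj ((constantSheaf τ.topology AddCommGrpCat.{u}).obj A)).obj where
  app U := φ.constSection A ≫
    (φ.inverseImage.obj ((constantSheaf τ.topology AddCommGrpCat.{u}).obj A)).obj.map
      (φ.toPreimageTop U.unop).op
  naturality := by
    intro U V f
    have h : f.unop ≫ φ.toPreimageTop U.unop = φ.toPreimageTop V.unop ≫
        φ.preimage.map (⟨f.unop.elt, fun _ _ => trivial⟩ : (⟨⊤⟩ : τ.EqOpens).Hom ⟨⊤⟩) :=
      EqOpens.hom_ext (add_comm _ _)
    refine (Category.id_comp _).trans ?_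
    rw [Category.assoc, ← Functor.map_comp]
    refine Eq.trans ?_ (congrArg (fun g => φ.constSection A ≫ (φ.inverseImage.obj
      ((constantSheaf τ.topology AddCommGrpCat.{u}).obj A)).obj.map (Quiver.Hom.op g)) h.symm)
    refine Eq.trans ?_ (congrArg (fun g => φ.constSection A ≫ g)
      (Functor.map_comp _ (φ.preimage.map _).op (φ.toPreimageTop V.unop).op).symm)
    rw [← Category.assoc, constSection_map]

/-- The canonical map `A_N ⟶ φ⁻¹ A_M` of equivariant sheaves, for the constant sheaves `A_N` and
`A_M` with value `A`. -/
def constMap (A : AddCommGrpCat.{u}) :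
    (constantSheaf τ'.topology AddCommGrpCat.{u}).obj A ⟶
      φ.inverseImage.obj ((constantSheaf τ.topology AddCommGrpCat.{u}).obj A) :=
  ((sheafificationAdjunction τ'.topology AddCommGrpCat.{u}).homEquiv _ _).symm
    (φ.constPresheafMap A)

/-- The pullback `φ^* : H^n(M; ℤ/2, 𝒰^ε) → H^n(N; ℤ/2, 𝒰^ε)`: apply the exact functor `φ⁻¹` to
`Ext^n(ℤ, 𝒰^ε)`, then compose with `φ⁻¹ 𝒰^ε ⟶ 𝒰^ε` and with `ℤ ⟶ φ⁻¹ ℤ`. -/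
def pullback (ε : ZMod 2) (n : ℕ) :
    τ.Cohomology (τ.unitary ε) n →+ τ'.Cohomology (τ'.unitary ε) n :=
  ((Abelian.Ext.mk₀ (φ.constMap (AddCommGrpCat.of (ULift ℤ)))).precomp _ (zero_add n)).comp
    (((Abelian.Ext.mk₀ (φ.pullUnitary ε)).postcomp _ (add_zero n)).comp
      (φ.inverseImage.mapExtAddHom _ _ n))

end EquivariantMap

/-! ### Sign choices -/

/-- The one-point orientifold. -/
def pointInvolution : SmoothInvolution 𝓘(ℝ, PUnit.{u + 1}) PUnit.{u + 1} where
  toFun := id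
  smooth := contMDiff_id
  involutive _ := rfl

namespace SmoothInvolution

variable (τ : SmoothInvolution I M)

/-- The fixed point set `M^τ` (with the subspace topology). -/
abbrev FixedPoints : Type u := {m : M // τ.toFun m = m}

/-- The inclusion `ι_m` of a fixed point `m`. -/
def pointInclusion (m : τ.FixedPoints) : EquivariantMap pointInvolution.{u} τ where
  toFun _ := m.1
  smooth := contMDiff_const
  equivariant _ := m.2.symm

/-- The identification of `H^n(pt; ℤ/2, 𝒰^{[n+1]})`, a group with two elements, with `ℤ/2`: the
trivial class has sign `0`, and the non-trivial class has sign `1`. -/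
def pointSign (n : ℕ) (c : pointInvolution.{u}.GerbeClass n) : ZMod 2 :=
  open scoped Classical in if c = 0 then 0 else 1

/-- The sign choice `σ_n(ξ)`: its value at a fixed point `m` is `ι_m^* ξ`. -/
def signChoice (n : ℕ) (ξ : τ.GerbeClass n) : τ.FixedPoints → ZMod 2 := fun m =>
  pointSign n ((τ.pointInclusion m).pullback _ n ξ)

end SmoothInvolution

end Sections
end Orientifold
end

/-!
The key fact is that the cohomology of an induced sheaf vanishes locally at fixed points. Here
`SmoothInvolution.ind` is the functor `G ↦ G ⊗ ℤ[ℤ/2]` on equivariant sheaves. It is adjoint to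
itself (`indAdjunction`), hence exact, and it preserves injective objects. A class in
`Ext^{n+1}(X, ind F)` can therefore be shifted down, along an embedding of `F` in an injective
sheaf, to a morphism from `X` to an induced sheaf `ind Q`, and the obstruction to lifting it along
`ind F' ⟶ ind Q` is killed by a pullback `X' ⟶ X`. Invariant sections of `ind Q` are the same as
plain sections of `Q`, which lift locally, so invariant sections of `X` lift to `X'` on small
invariant neighbourhoods of a fixed point; this is
`exists_liftsInvariantSections_comp_induced_eq_zero`.

On the point, lifting the unit section of `ℤ` splits `X' ⟶ ℤ`, so `ind U(1)` has no cohomology in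
positive degree. In degree zero the norm map `z ↦ z · z̄` is trivial. Hence all connecting
homomorphisms of the point are isomorphisms (`point_gerbeConnecting_bijective`), and its groups
`H^n(pt; ℤ/2, 𝒰^{[n+1]})` are all isomorphic to the group `{1, -1}` of invariants for `n = 0`.

Pullback to a fixed point commutes with the connecting homomorphisms
(`EquivariantMap.extPullback_extensionClass`), and the connecting homomorphism of the point
preserves signs because it is injective. This gives `σ_{n+1} ∘ ∂ = σ_n`.

For local constancy, signs are defined for classes in `Ext^n(X, 𝒰^{[n+1]})` relative to an
invariant section of `X` near a fixed point (`extSign`). Replacing `X` by `X'` plays the role of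
restricting to a neighbourhood: there the image of the class in the cohomology of `ind 𝒰(1)`
vanishes, so the class comes from degree `n - 1` under a connecting homomorphism and has the same
signs as a class of lower degree. In degree zero a class is an invariant function with values in
`U(1)`, which is `1` or `-1` at fixed points, and its sign is locally constant by continuity.
-/

noncomputable section

namespace Orientifold

variable {E : Type*} [NormedAddCommGroup E] [NormedSpace ℝ E] {H : Type*}
  [TopologicalSpace H] {I : ModelWithCorners ℝ E H} {M : Type u} [TopologicalSpace M]
  [ChartedSpace H M]
variable {E' : Type*} [NormedAddCommGroup E'] [NormedSpace ℝ E'] {H' : Type*}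
  [TopologicalSpace H'] {J : ModelWithCorners ℝ E' H'} {N : Type u} [TopologicalSpace N]
  [ChartedSpace H' N]

/-! ### Induced equivariant sheaves -/

theorem zmod_two_add_add_cancel (h k : ZMod 2) : h + k + k = h := by
  rw [add_assoc, CharTwo.add_self_eq_zero, add_zero]

namespace SmoothInvolution

variable (τ : SmoothInvolution I M)

/-- Restriction of pairs of sections of `P`: a morphism `f` given by `g ∈ ℤ/2` restricts both
components and permutes them by `g`. -/
def indMap (P : τ.EqOpensᵒᵖ ⥤ AddCommGrpCat.{u}) {U V : τ.EqOpensᵒᵖ} (f : U ⟶ V) :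
    (ZMod 2 → P.obj U) →+ (ZMod 2 → P.obj V) where
  toFun a h := (P.map f).hom (a (h + f.unop.elt))
  map_zero' := funext fun _ => map_zero _
  map_add' _ _ := funext fun _ => map_add _ _ _

theorem indMap_apply (P : τ.EqOpensᵒᵖ ⥤ AddCommGrpCat.{u}) {U V : τ.EqOpensᵒᵖ} (f : U ⟶ V)
    (a : ZMod 2 → P.obj U) (h : ZMod 2) :
    τ.indMap P f a h = (P.map f).hom (a (h + f.unop.elt)) := rfl

theorem indMap_single (P : τ.EqOpensᵒᵖ ⥤ AddCommGrpCat.{u}) {U V : τ.EqOpensᵒᵖ} (f : U ⟶ V)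
    (h : ZMod 2) (x : P.obj U) :
    τ.indMap P f (Pi.single h x) = Pi.single (h + f.unop.elt) ((P.map f).hom x) := by
  funext k
  rw [indMap_apply]
  by_cases hk : k = h + f.unop.elt
  · subst hk
    rw [zmod_two_add_add_cancel, Pi.single_eq_same, Pi.single_eq_same]
  · rw [Pi.single_eq_of_ne hk, Pi.single_eq_of_ne, map_zero]
    rintro rfl
    exact hk (zmod_two_add_add_cancel _ _).symm

/-- The presheaf `P ⊗ ℤ[ℤ/2]`, with `ℤ/2` acting diagonally. -/
def indPresheaf (P : τ.EqOpensᵒᵖ ⥤ AddCommGrpCat.{u}) : τ.EqOpensᵒᵖ ⥤ AddCommGrpCat.{u} where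
  obj U := AddCommGrpCat.of (ZMod 2 → P.obj U)
  map f := AddCommGrpCat.ofHom (τ.indMap P f)
  map_id U := by
    refine AddCommGrpCat.hom_ext (AddMonoidHom.ext fun a => funext fun h => ?_)
    change (P.map (𝟙 U)).hom (a (h + 0)) = a h
    rw [P.map_id, add_zero]; rfl
  map_comp {U V W} f g := by
    refine AddCommGrpCat.hom_ext (AddMonoidHom.ext fun a => funext fun h => ?_)
    change (P.map (f ≫ g)).hom (a (h + (f.unop.elt + g.unop.elt))) =
      (P.map g).hom ((P.map f).hom (a (h + g.unop.elt + f.unop.elt)))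
    rw [P.map_comp, add_assoc h, add_comm g.unop.elt]; rfl

theorem isSheaf_indPresheaf (G : τ.EqSheaf) :
    Presheaf.IsSheaf τ.topology (τ.indPresheaf G.obj) := by
  have hG := G.property
  rw [Presheaf.isSheaf_iff_isSheaf_forget _ _ (forget AddCommGrpCat.{u}),
    isSheaf_iff_isSheaf_of_type] at hG ⊢
  intro V S hS a ha
  -- the `k`-th component of the glued section restricts to `a f (k + g)` along a translate by `g`
  let b : ∀ k : ZMod 2, Presieve.FamilyOfElements (G.obj ⋙ forget AddCommGrpCat.{u}) S.arrows :=
    fun k U f hf => (show ZMod 2 → G.obj.obj (op U) from a f hf) (k + f.elt)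
  have hb : ∀ k, (b k).Compatible := by
    intro k U₁ U₂ Z g₁ g₂ f₁ f₂ h₁ h₂ e
    have h := congrFun (show (_ : ZMod 2 → G.obj.obj (op Z)) = _ from ha g₁ g₂ h₁ h₂ e)
      (k + (f₁.elt + g₁.elt))
    have e' : f₁.elt + g₁.elt = f₂.elt + g₂.elt := congrArg EqOpens.Hom.elt e
    have h₁' : k + (f₁.elt + g₁.elt) + g₁.elt = k + f₁.elt := by
      rw [← add_assoc, zmod_two_add_add_cancel]
    have h₂' : k + (f₁.elt + g₁.elt) + g₂.elt = k + f₂.elt := by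
      rw [e', ← add_assoc, zmod_two_add_add_cancel]
    change (G.obj.map g₁.op).hom ((show ZMod 2 → G.obj.obj (op U₁) from a f₁ h₁) (k + f₁.elt)) =
      (G.obj.map g₂.op).hom ((show ZMod 2 → G.obj.obj (op U₂) from a f₂ h₂) (k + f₂.elt))
    rw [← h₁', ← h₂']
    exact h
  choose s hs hu using fun k => hG S hS (b k) (hb k)
  refine ⟨s, fun U f hf => ?_, fun t ht => ?_⟩
  · refine funext fun h => (hs (h + f.elt) f hf).trans ?_
    change (show ZMod 2 → G.obj.obj (op U) from a f hf) (h + f.elt + f.elt) = _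
    rw [zmod_two_add_add_cancel]
  · refine funext fun k => hu k _ fun U f hf => ?_
    have h := congrFun (show (_ : ZMod 2 → G.obj.obj (op U)) = _ from ht f hf) (k + f.elt)
    refine Eq.trans ?_ h
    change _ = (G.obj.map f.op).hom ((show ZMod 2 → G.obj.obj (op V) from t) (k + f.elt + f.elt))
    rw [zmod_two_add_add_cancel]; rfl

/-- The functor `G ↦ G ⊗ ℤ[ℤ/2]` on equivariant sheaves. It forgets the equivariance of `G` and
induces the resulting sheaf up again. -/
def ind : τ.EqSheaf ⥤ τ.EqSheaf where
  obj G := ⟨τ.indPresheaf G.obj, τ.isSheaf_indPresheaf G⟩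
  map {G _} φ :=
    { hom :=
      { app := fun U => AddCommGrpCat.ofHom ((φ.hom.app U).hom.compLeft (ZMod 2))
        naturality := fun U _ f => AddCommGrpCat.hom_ext (AddMonoidHom.ext fun a =>
          funext fun h => congrArg (fun q => q.hom ((show ZMod 2 → G.obj.obj U from a)
            (h + f.unop.elt))) (φ.hom.naturality f)) } }
  map_id _ := rfl
  map_comp _ _ := rfl

variable {τ}

theorem EqSheaf.naturality_apply {G G' : τ.EqSheaf} (φ : G ⟶ G') {U V : τ.EqOpensᵒᵖ} (f : U ⟶ V)
    (x : G.obj.obj U) :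
    (φ.hom.app V).hom ((G.obj.map f).hom x) = (G'.obj.map f).hom ((φ.hom.app U).hom x) :=
  congrArg (fun q => q.hom x) (φ.hom.naturality f)

theorem EqSheaf.hom_ext {G G' : τ.EqSheaf} {φ ψ : G ⟶ G'}
    (h : ∀ U (x : G.obj.obj U), (φ.hom.app U).hom x = (ψ.hom.app U).hom x) : φ = ψ :=
  Sheaf.hom_ext (NatTrans.ext (funext fun U => AddCommGrpCat.hom_ext (AddMonoidHom.ext (h U))))

/-- The morphism `G ⟶ ind G'` adjoint to `φ : ind G ⟶ G'`. -/
def indTranspose {G G' : τ.EqSheaf} (φ : τ.ind.obj G ⟶ G') : G ⟶ τ.ind.obj G' where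
  hom :=
    { app := fun U => AddCommGrpCat.ofHom (Y := ZMod 2 → G'.obj.obj U)
        { toFun := fun x h => (φ.hom.app U).hom (Pi.single h x : ZMod 2 → G.obj.obj U)
          map_zero' := funext fun h => by
            rw [Pi.single_zero]; exact map_zero _
          map_add' := fun x y => funext fun h => by
            rw [Pi.single_add]; exact map_add (φ.hom.app U).hom _ _ }
      naturality := fun U V f => AddCommGrpCat.hom_ext (AddMonoidHom.ext fun x =>
        funext fun h => by
          have e := EqSheaf.naturality_apply φ f
            (Pi.single (h + f.unop.elt) x : ZMod 2 → G.obj.obj U)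
          refine Eq.trans (congrArg (φ.hom.app V).hom ?_) e
          refine Eq.trans ?_ (τ.indMap_single G.obj f _ x).symm
          rw [zmod_two_add_add_cancel]; rfl) }

/-- The morphism `ind G ⟶ G'` adjoint to `φ : G ⟶ ind G'`. -/
def indCotranspose {G G' : τ.EqSheaf} (φ : G ⟶ τ.ind.obj G') : τ.ind.obj G ⟶ G' where
  hom :=
    { app := fun U => AddCommGrpCat.ofHom (X := ZMod 2 → G.obj.obj U)
        { toFun := fun a => ∑ h, (show ZMod 2 → G'.obj.obj U from (φ.hom.app U).hom (a h)) h
          map_zero' := Finset.sum_eq_zero (M := G'.obj.obj U) fun h _ => by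
            rw [Pi.zero_apply, map_zero]; rfl
          map_add' := fun a b => by
            refine Eq.trans (Finset.sum_congr (M := G'.obj.obj U) rfl fun h _ => ?_)
              Finset.sum_add_distrib
            rw [Pi.add_apply, map_add]; rfl }
      naturality := fun U V f => AddCommGrpCat.hom_ext (AddMonoidHom.ext fun a => by
        let a' : ZMod 2 → G.obj.obj U := a
        let φa : ZMod 2 → ZMod 2 → G'.obj.obj U := fun h => (φ.hom.app U).hom (a' h)
        change (∑ h, (show ZMod 2 → G'.obj.obj V from
          (φ.hom.app V).hom (τ.indMap G.obj f a' h)) h) = (G'.obj.map f).hom (∑ h, φa h h)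
        rw [map_sum]
        exact Fintype.sum_equiv (Equiv.addRight f.unop.elt) _ _ fun h =>
          congrFun (EqSheaf.naturality_apply φ f (a' (h + f.unop.elt))) h) }

variable (τ) in
/-- Since `ℤ/2` is finite, inducing is adjoint to itself: morphisms `ind G ⟶ G'` and `G ⟶ ind G'`
are both the same as morphisms of the underlying non-equivariant sheaves. -/
def indAdjunction : τ.ind ⊣ τ.ind :=
  Adjunction.mkOfHomEquiv
    { homEquiv := fun G G' =>
        { toFun := indTranspose
          invFun := indCotranspose
          left_inv := fun φ => EqSheaf.hom_ext fun U a => by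
            change (∑ h, (φ.hom.app U).hom (Pi.single h ((show ZMod 2 → G.obj.obj U from a) h) :
              ZMod 2 → G.obj.obj U)) = (φ.hom.app U).hom a
            refine (map_sum (φ.hom.app U).hom (fun h => (Pi.single h
              ((show ZMod 2 → G.obj.obj U from a) h) : ZMod 2 → G.obj.obj U))
              Finset.univ).symm.trans (congrArg _ ?_)
            exact Finset.univ_sum_single (show ZMod 2 → G.obj.obj U from a)
          right_inv := fun φ => EqSheaf.hom_ext fun U x => funext fun h => by
            change (∑ k, (show ZMod 2 → G'.obj.obj U from (φ.hom.app U).hom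
              ((Pi.single h x : ZMod 2 → G.obj.obj U) k)) k) = _
            rw [Finset.sum_eq_single h]
            · rw [Pi.single_eq_same]
            · intro k _ hk
              rw [Pi.single_eq_of_ne hk, map_zero]; rfl
            · exact fun h' => absurd (Finset.mem_univ h) h' }
      homEquiv_naturality_left_symm := fun f g => rfl
      homEquiv_naturality_right := fun f g => rfl }

instance : τ.ind.IsRightAdjoint := τ.indAdjunction.isRightAdjoint

instance : τ.ind.IsLeftAdjoint := τ.indAdjunction.isLeftAdjoint

instance : τ.ind.Additive := Functor.additive_of_preserves_binary_products _

theorem injective_ind (G : τ.EqSheaf) [Injective G] : Injective (τ.ind.obj G) :=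
  Injective.injective_of_adjoint τ.indAdjunction G

variable (τ) in
/-- The sheaf `ind 𝒰(1)` is induced from the equivariant sheaf `𝒰^0`: a function on `h U` is
identified with its translate on `U`. -/
def inducedToInd : τ.induced ⟶ τ.ind.obj (τ.unitary 0) where
  hom :=
    { app := fun U => AddCommGrpCat.ofHom (X := τ.InducedSec U.unop.carrier)
        (Y := ZMod 2 → Sec I U.unop.carrier)
        { toFun := fun a h =>
            Sec.pull (τ.act h) (τ.smooth_act h) (τ.act_mem_translate h) (a h)
          map_zero' := rfl
          map_add' := fun _ _ => rfl }
      naturality := fun U V f => AddCommGrpCat.hom_ext (AddMonoidHom.ext fun a =>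
        funext fun h => Sec.ext fun x hx => by
          refine Eq.trans ?_ (τ.unitaryPresheaf_map_val 0 f.unop (Sec.pull (τ.act _)
            (τ.smooth_act _) (τ.act_mem_translate (h + f.unop.elt))
            ((show τ.InducedSec U.unop.carrier from a) (h + f.unop.elt))) x hx).symm
          have hx' : τ.act h x = τ.act (h + f.unop.elt) (τ.act f.unop.elt x) := by
            rw [act_add, act_act_self]
          rw [show conj 0 f.unop.elt (Additive Circle) = AddMonoidHom.id _ by simp [conj]]
          refine (Sec.val_congr _ hx' _).trans ?_
          exact InducedSec.val_congr (show τ.InducedSec U.unop.carrier from a)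
            (add_comm f.unop.elt h) _) }

variable (τ) in
/-- The inverse of `inducedToInd`. -/
def indToInduced : τ.ind.obj (τ.unitary 0) ⟶ τ.induced where
  hom :=
    { app := fun U => AddCommGrpCat.ofHom (X := ZMod 2 → Sec I U.unop.carrier)
        (Y := τ.InducedSec U.unop.carrier)
        { toFun := fun b h => Sec.pull (τ.act h) (τ.smooth_act h)
            (fun x (hx : x ∈ τ.translate h U.unop.carrier) => hx) (b h)
          map_zero' := rfl
          map_add' := fun _ _ => rfl }
      naturality := fun U V f => AddCommGrpCat.hom_ext (AddMonoidHom.ext fun b =>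
        funext fun h => Sec.ext fun x hx => by
          refine (τ.unitaryPresheaf_map_val 0 f.unop ((show ZMod 2 → Sec I U.unop.carrier from b)
            (h + f.unop.elt)) (τ.act h x) hx).trans ?_
          rw [show conj 0 f.unop.elt (Additive Circle) = AddMonoidHom.id _ by simp [conj]]
          have key : ∀ (k : ZMod 2) (hk : k = h + f.unop.elt) (y : M) (hy : y ∈ U.unop.carrier)
              (hky : τ.act k x = y), ((show ZMod 2 → Sec I U.unop.carrier from b)
                (h + f.unop.elt)).val y hy = ((show ZMod 2 → Sec I U.unop.carrier from b) k).val
                  (τ.act k x) (hky ▸ hy) := by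
            rintro k rfl y hy rfl; rfl
          exact key (f.unop.elt + h) (add_comm _ _) _ _ (τ.act_add _ _ _)) }

variable (τ) in
theorem inducedToInd_indToInduced : τ.inducedToInd ≫ τ.indToInduced = 𝟙 _ :=
  EqSheaf.hom_ext fun U a => funext fun h => Sec.ext fun x _ =>
    Sec.val_congr ((show τ.InducedSec U.unop.carrier from a) h) (τ.act_act_self h x) _

end SmoothInvolution
/-! ### Invariant sections and local vanishing for induced sheaves -/

/-- Homomorphisms out of `ℤ` agree if they agree at `1`. -/
theorem uliftInt_hom_ext {B : AddCommGrpCat.{u}} {f g : AddCommGrpCat.of (ULift.{u} ℤ) ⟶ B}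
    (h : f.hom (ULift.up 1) = g.hom (ULift.up 1)) : f = g :=
  (AddCommGrpCat.uliftZMultiplesAddEquiv B).injective h

theorem exists_uliftInt_hom {B : AddCommGrpCat.{u}} (b : B) :
    ∃ f : AddCommGrpCat.of (ULift.{u} ℤ) ⟶ B, f.hom (ULift.up 1) = b :=
  (AddCommGrpCat.uliftZMultiplesAddEquiv B).surjective b

section Abelian

variable {C : Type*} [Category* C] [Abelian C]

/-- The sequence `0 ⟶ F ⟶ F' ⟶ F'/F ⟶ 0` for a chosen embedding of `F` in an injective object. -/
def injectiveShortComplex [EnoughInjectives C] (F : C) : ShortComplex C :=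
  ShortComplex.mk (Injective.ι F) (Limits.cokernel.π (Injective.ι F)) (by simp)

theorem injectiveShortComplex_shortExact [EnoughInjectives C] (F : C) :
    (injectiveShortComplex F).ShortExact where
  exact := ShortComplex.exact_cokernel _
  mono_f := inferInstanceAs (Mono (Injective.ι F))
  epi_g := inferInstanceAs (Epi (Limits.cokernel.π (Injective.ι F)))

open Abelian

theorem mk₀_comp_comp_extClass_eq_zero [HasExt.{u} C] {S : ShortComplex C} (hS : S.ShortExact)
    {X' X : C} {n : ℕ} {p : X' ⟶ X} {z : Ext X S.X₃ n}
    (h : (Ext.mk₀ p).comp z (zero_add n) = 0) :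
    (Ext.mk₀ p).comp (z.comp hS.extClass rfl) (zero_add (n + 1)) = 0 := by
  rw [← Ext.comp_assoc (a₁₂ := n) _ _ _ (zero_add n) rfl (by lia), h, Ext.zero_comp]

theorem mk₀_comp_mk₀_comp_extClass_eq_zero [HasExt.{u} C] {S : ShortComplex C}
    (hS : S.ShortExact) {X' X : C} {p : X' ⟶ X} {z : X ⟶ S.X₃} {q : X' ⟶ S.X₂}
    (h : p ≫ z = q ≫ S.g) :
    (Ext.mk₀ p).comp ((Ext.mk₀ z).comp hS.extClass (zero_add 1)) (zero_add 1) = 0 := by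
  rw [Ext.mk₀_comp_mk₀_assoc, h, ← Ext.mk₀_comp_mk₀_assoc, hS.comp_extClass, Ext.comp_zero]

end Abelian

namespace SmoothInvolution

variable {τ : SmoothInvolution I M}

/-- A `ℤ/2`-invariant section of the equivariant sheaf `X` over the invariant open set `W`, encoded
as a homomorphism `ℤ ⟶ X(W)`. -/
structure InvariantSection (X : τ.EqSheaf) (W : τ.EqOpens) where
  act_mem : ∀ g : ZMod 2, ∀ x ∈ W.carrier, τ.act g x ∈ W.carrier
  hom : AddCommGrpCat.of (ULift.{u} ℤ) ⟶ X.obj.obj (op W)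
  invariant : ∀ g : ZMod 2, hom ≫ X.obj.map (Quiver.Hom.op (EqOpens.Hom.mk g (act_mem g) :
    W ⟶ W)) = hom

/-- The inclusion of an open set in a larger one. -/
def EqOpens.incl {U V : τ.EqOpens} (h : U.carrier ≤ V.carrier) : U ⟶ V := ⟨0, fun _ hx => h hx⟩

/-- The invariant section of `Y` which is the image of an invariant section of `X`. -/
def InvariantSection.map {X Y : τ.EqSheaf} {W : τ.EqOpens} (t : InvariantSection X W) (p : X ⟶ Y) :
    InvariantSection Y W where
  act_mem := t.act_mem
  hom := t.hom ≫ p.hom.app (op W)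
  invariant g := by
    rw [Category.assoc, ← p.hom.naturality, ← Category.assoc, t.invariant]

/-- The morphism `p : X' ⟶ X` is surjective on germs of invariant sections at fixed points. -/
def LiftsInvariantSections {X' X : τ.EqSheaf} (p : X' ⟶ X) : Prop :=
  ∀ (W : τ.EqOpens) (t : InvariantSection X W) (m : M), m ∈ W.carrier → τ.toFun m = m →
    ∃ (W' : τ.EqOpens) (h : W'.carrier ≤ W.carrier) (t' : InvariantSection X' W'),
      m ∈ W'.carrier ∧ t'.hom ≫ p.hom.app (op W') = t.hom ≫ X.obj.map (EqOpens.incl h).op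

theorem act_fixed {m : M} (hm : τ.toFun m = m) (g : ZMod 2) : τ.act g m = m := by
  unfold act; split_ifs
  exacts [rfl, hm]

/-- An invariant section of `ind Q` is a section of `Q`, and sections of `Q` lift locally along an
epimorphism to `Q`. -/
theorem liftsInvariantSections_ind_map {G Q : τ.EqSheaf} (π : G ⟶ Q) [Epi π] :
    LiftsInvariantSections (τ.ind.map π) := by
  intro W t m hm hfix
  have hπ : Sheaf.IsLocallySurjective π := (Sheaf.isLocallySurjective_iff_epi' _ π).2 inferInstance
  let q : ZMod 2 → Q.obj.obj (op W) := t.hom.hom (ULift.up 1)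
  -- by invariance the component `q 0` determines the others, so it is enough to lift `q 0`
  have hq : ∀ g, (Q.obj.map (Quiver.Hom.op (EqOpens.Hom.mk g (t.act_mem g) : W ⟶ W))).hom (q g) =
      q 0 := by
    intro g
    have := congrFun (show τ.indMap Q.obj (Quiver.Hom.op (EqOpens.Hom.mk g (t.act_mem g) :
      W ⟶ W)) q = q from congrArg (fun f => f.hom (ULift.up 1)) (t.invariant g)) 0
    rw [indMap_apply, zero_add] at this
    exact this
  obtain ⟨U, f, ⟨j, hj⟩, y, hy, hyx⟩ := Presheaf.imageSieve_mem τ.topology π.hom (q 0) m hm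
  -- the lift `j` lives on `U`, and `U` contains `m` because `m` is fixed
  have hym : y = m := by
    rw [← act_act_self τ f.elt y, hyx, act_fixed hfix]
  subst hym
  let W' : τ.EqOpens := ⟨U.carrier ⊓ τ.translate 1 U.carrier⟩
  have hW' : ∀ g : ZMod 2, ∀ x ∈ W'.carrier, τ.act g x ∈ W'.carrier := by
    intro g x hx
    fin_cases g
    · exact hx
    · exact ⟨hx.2, by change τ.act 1 (τ.act 1 x) ∈ U.carrier; rw [act_act_self]; exact hx.1⟩
  have hle : W'.carrier ≤ W.carrier := by
    intro x hx
    have := f.act_mem _ (hW' f.elt x hx).1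
    rwa [act_act_self] at this
  -- `k` undoes the group element of `f`, so that `k ≫ f` is an honest inclusion
  let k : W' ⟶ U := ⟨f.elt, fun x hx => (hW' f.elt x hx).1⟩
  have hkf : k ≫ f = EqOpens.incl hle := EqOpens.hom_ext (CharTwo.add_self_eq_zero _)
  let j' : G.obj.obj (op W') := (G.obj.map k.op).hom j
  have hj' : (π.hom.app (op W')).hom j' = (Q.obj.map (EqOpens.incl hle).op).hom (q 0) := by
    refine (EqSheaf.naturality_apply π k.op j).trans ?_
    rw [← hkf, op_comp, Q.obj.map_comp]
    exact congrArg (Q.obj.map k.op).hom hj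
  -- the invariant section with component `j'` at `0`
  let ρ : ZMod 2 → (W' ⟶ W') := fun g => ⟨g, hW' g⟩
  let b : ZMod 2 → G.obj.obj (op W') := fun h => (G.obj.map (ρ h).op).hom j'
  obtain ⟨t', ht'⟩ := exists_uliftInt_hom (B := (τ.ind.obj G).obj.obj (op W')) b
  refine ⟨W', hle, ⟨hW', t', fun g => uliftInt_hom_ext ?_⟩, ⟨hy, ?_⟩, uliftInt_hom_ext ?_⟩
  · change τ.indMap G.obj (ρ g).op (t'.hom (ULift.up 1)) = t'.hom (ULift.up 1)
    rw [ht']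
    funext h
    rw [indMap_apply]
    change (G.obj.map (ρ g).op).hom ((G.obj.map (ρ (h + g)).op).hom j') =
      (G.obj.map (ρ h).op).hom j'
    have e : ρ h = ρ g ≫ ρ (h + g) := EqOpens.hom_ext (zmod_two_add_add_cancel h g).symm
    rw [e, op_comp, G.obj.map_comp]; rfl
  · change τ.act 1 y ∈ U.carrier
    rw [act_fixed hfix]; exact hy
  · change ((τ.ind.map π).hom.app (op W')).hom (t'.hom (ULift.up 1)) =
      τ.indMap Q.obj (EqOpens.incl hle).op q
    rw [ht']
    funext h
    refine (EqSheaf.naturality_apply π (ρ h).op j').trans ?_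
    rw [hj', indMap_apply, ← hq (h + (EqOpens.incl hle : W' ⟶ W).elt)]
    have e : ρ h ≫ EqOpens.incl hle ≫ (EqOpens.Hom.mk (h + (EqOpens.incl hle : W' ⟶ W).elt)
        (t.act_mem _) : W ⟶ W) = EqOpens.incl hle := by
      refine EqOpens.hom_ext ?_
      change h + 0 + 0 + h = 0
      rw [add_zero, add_zero, CharTwo.add_self_eq_zero]
    have e' := congrArg (fun r => (Q.obj.map (Quiver.Hom.op r)).hom
      (q (h + (EqOpens.incl hle : W' ⟶ W).elt))) e
    refine Eq.trans ?_ e'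
    rw [op_comp, op_comp, Q.obj.map_comp, Q.obj.map_comp]; rfl

/-- The sections of a pullback are pairs of sections, and such a pair is invariant as soon as both
of its components are. -/
theorem LiftsInvariantSections.of_isPullback {P X Y Z : τ.EqSheaf} {fst : P ⟶ X} {snd : P ⟶ Y}
    {f : X ⟶ Z} {g : Y ⟶ Z} (sq : IsPullback fst snd f g) (hg : LiftsInvariantSections g) :
    LiftsInvariantSections fst := by
  intro W t m hm hfix
  obtain ⟨W', h, t', hm', e⟩ := hg W (t.map f) m hm hfix
  have sq' := (sq.map (sheafToPresheaf τ.topology AddCommGrpCat.{u})).map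
    ((evaluation _ _).obj (op W'))
  let l := sq'.lift (t.hom ≫ X.obj.map (EqOpens.incl h).op) t'.hom (by
    refine Eq.trans ?_ e.symm
    refine (Category.assoc _ _ _).trans (Eq.trans ?_ (Category.assoc _ _ _).symm)
    exact congrArg _ (f.hom.naturality _))
  have l1 : l ≫ fst.hom.app (op W') = t.hom ≫ X.obj.map (EqOpens.incl h).op := sq'.lift_fst _ _ _
  have l2 : l ≫ snd.hom.app (op W') = t'.hom := sq'.lift_snd _ _ _
  refine ⟨W', h, ⟨t'.act_mem, l, fun g => sq'.hom_ext ?_ ?_⟩, hm', l1⟩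
  · change (l ≫ P.obj.map _) ≫ fst.hom.app _ = l ≫ fst.hom.app _
    rw [Category.assoc, fst.hom.naturality, ← Category.assoc, l1, Category.assoc,
      ← X.obj.map_comp, ← op_comp]
    have e : (EqOpens.Hom.mk g (t'.act_mem g) : W' ⟶ W') ≫ EqOpens.incl h =
        EqOpens.incl h ≫ (EqOpens.Hom.mk g (t.act_mem g) : W ⟶ W) :=
      EqOpens.hom_ext (add_comm _ _)
    rw [e, op_comp, X.obj.map_comp, ← Category.assoc, t.invariant]
  · change (l ≫ P.obj.map _) ≫ snd.hom.app _ = l ≫ snd.hom.app _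
    rw [Category.assoc, snd.hom.naturality, ← Category.assoc, l2, t'.invariant]

open Abelian in
/-- A class of positive degree with values in an induced sheaf vanishes locally at fixed points.
The class is shifted down to degree zero along an injective resolution of `F`, which stays an
injective resolution after inducing; there it is a question of lifting sections. -/
theorem exists_liftsInvariantSections_comp_eq_zero (n : ℕ) (F X : τ.EqSheaf)
    (y : Ext X (τ.ind.obj F) (n + 1)) :
    ∃ (X' : τ.EqSheaf) (p : X' ⟶ X), LiftsInvariantSections p ∧
      (Ext.mk₀ p).comp y (zero_add _) = 0 := by
  induction n generalizing F X with
  | zero =>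
    have hT := (injectiveShortComplex_shortExact F).map_of_exact τ.ind
    have : Injective ((injectiveShortComplex F).map τ.ind).X₂ := injective_ind (Injective.under F)
    obtain ⟨z, rfl⟩ := Ext.covariant_sequence_exact₁ X hT y (Ext.eq_zero_of_injective _) rfl
    obtain ⟨z, rfl⟩ := (Ext.mk₀_bijective _ _).2 z
    have : Epi (injectiveShortComplex F).g := (injectiveShortComplex_shortExact F).epi_g
    have sq := IsPullback.of_hasPullback z (τ.ind.map (injectiveShortComplex F).g)
    exact ⟨_, _, .of_isPullback sq (liftsInvariantSections_ind_map _),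
      mk₀_comp_mk₀_comp_extClass_eq_zero hT sq.w⟩
  | succ n ih =>
    have hT := (injectiveShortComplex_shortExact F).map_of_exact τ.ind
    have : Injective ((injectiveShortComplex F).map τ.ind).X₂ := injective_ind (Injective.under F)
    obtain ⟨z, rfl⟩ := Ext.covariant_sequence_exact₁ X hT y (Ext.eq_zero_of_injective _) rfl
    obtain ⟨X', p, hp, e⟩ := ih _ X z
    exact ⟨X', p, hp, mk₀_comp_comp_extClass_eq_zero hT e⟩

open Abelian in
/-- The vanishing of `exists_liftsInvariantSections_comp_eq_zero` for `ind 𝒰(1)`. -/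
theorem exists_liftsInvariantSections_comp_induced_eq_zero (n : ℕ) (X : τ.EqSheaf)
    (y : Ext X τ.induced (n + 1)) :
    ∃ (X' : τ.EqSheaf) (p : X' ⟶ X), LiftsInvariantSections p ∧
      (Ext.mk₀ p).comp y (zero_add _) = 0 := by
  obtain ⟨X', p, hp, e⟩ := exists_liftsInvariantSections_comp_eq_zero n _ X
    (y.comp (Ext.mk₀ τ.inducedToInd) (add_zero _))
  refine ⟨X', p, hp, ?_⟩
  have e' := congrArg (fun w => w.comp (Ext.mk₀ τ.indToInduced) (add_zero (n + 1))) e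
  simp only [Ext.comp_assoc_of_third_deg_zero, Ext.mk₀_comp_mk₀, inducedToInd_indToInduced,
    Ext.comp_mk₀_id, Ext.zero_comp] at e'
  exact e'

end SmoothInvolution

/-! ### Naturality of the connecting homomorphisms -/

namespace SmoothInvolution

/-- The class in `Ext¹(𝒰^{ε+1}, 𝒰^ε)` of the extension `ind 𝒰(1)`. -/
def extensionClass (τ : SmoothInvolution I M) {ε ε' : ZMod 2} (h : ε' = ε + 1) :
    Abelian.Ext (τ.unitary ε') (τ.unitary ε) 1 :=
  (τ.shortComplex_shortExact h).extClass

end SmoothInvolution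

namespace EquivariantMap

open SmoothInvolution

variable {τ' : SmoothInvolution J N} {τ : SmoothInvolution I M} (φ : EquivariantMap τ' τ)

theorem mem_translate {h : ZMod 2} {U : τ.EqOpens} {x : N}
    (hx : x ∈ τ'.translate h (φ.preimage.obj U).carrier) :
    φ.toFun x ∈ τ.translate h U.carrier := by
  change φ.toFun (τ'.act h x) ∈ U.carrier at hx
  rwa [map_act] at hx

/-- Composition with `φ`, as a morphism `ind 𝒰(1) ⟶ φ_* ind 𝒰(1)` of equivariant sheaves. -/
def compInduced : τ.induced ⟶ φ.directImage.obj τ'.induced where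
  hom :=
    { app := fun U => AddCommGrpCat.ofHom (X := τ.InducedSec U.unop.carrier)
        (Y := τ'.InducedSec (φ.preimage.obj U.unop).carrier)
        { toFun := fun a h => Sec.pull φ.toFun φ.smooth (fun _ hx => φ.mem_translate hx) (a h)
          map_zero' := rfl
          map_add' := fun _ _ => rfl }
      naturality := fun _ _ _ => rfl }

theorem toInduced_compInduced (ε : ZMod 2) :
    τ.toInduced ε ≫ φ.compInduced = φ.compUnitary ε ≫ φ.directImage.map (τ'.toInduced ε) :=
  EqSheaf.hom_ext fun U s => funext fun h => Sec.ext fun x hx => by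
    refine (τ.toInducedHom_val ε U.unop.carrier s h (φ.toFun x) (φ.mem_translate hx)).trans
      (Eq.trans ?_ (τ'.toInducedHom_val ε (φ.preimage.obj U.unop).carrier
        (Sec.pull φ.toFun φ.smooth (fun _ hx => hx) s) h x hx).symm)
    exact congrArg _ (Sec.val_congr s (φ.map_act _ _).symm _)

theorem norm_compUnitary (ε : ZMod 2) :
    τ.norm ε ≫ φ.compUnitary ε = φ.compInduced ≫ φ.directImage.map (τ'.norm ε) :=
  EqSheaf.hom_ext fun U a => Sec.ext fun x hx => by
    refine (τ.normHom_val ε U.unop.carrier a (φ.toFun x) hx).trans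
      (Eq.trans ?_ (τ'.normHom_val ε (φ.preimage.obj U.unop).carrier
        ((φ.compInduced.hom.app U).hom a) x hx).symm)
    refine Finset.sum_congr rfl fun h _ => congrArg _ ?_
    exact Sec.val_congr ((show τ.InducedSec U.unop.carrier from a) h) (φ.map_act _ _).symm _

/-- The pullback morphism `φ⁻¹ ind 𝒰(1) ⟶ ind 𝒰(1)`. -/
def pullInduced : φ.inverseImage.obj τ.induced ⟶ τ'.induced :=
  (φ.adjunction.homEquiv _ _).symm φ.compInduced

/-- The pullback morphisms form a morphism from the inverse image of the short exact sequence on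
`M` to the short exact sequence on `N`. -/
def pullShortComplex {ε ε' : ZMod 2} (h : ε' = ε + 1) :
    (τ.shortComplex h).map φ.inverseImage ⟶ τ'.shortComplex h where
  τ₁ := φ.pullUnitary ε
  τ₂ := φ.pullInduced
  τ₃ := φ.pullUnitary ε'
  comm₁₂ := by
    refine Eq.trans (φ.adjunction.homEquiv_naturality_right_symm _ _).symm
      (Eq.trans ?_ (φ.adjunction.homEquiv_naturality_left_symm _ _))
    exact congrArg _ (φ.toInduced_compInduced ε).symm
  comm₂₃ := by
    refine Eq.trans (φ.adjunction.homEquiv_naturality_right_symm _ _).symm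
      (Eq.trans ?_ (φ.adjunction.homEquiv_naturality_left_symm _ _))
    exact congrArg _ (φ.norm_compUnitary ε').symm

open Abelian

/-- The pullback `Ext^n(X, 𝒰^ε) → Ext^n(Y, 𝒰^ε)` along `φ` and a morphism `s : Y ⟶ φ⁻¹ X`. For
`s : ℤ ⟶ φ⁻¹ ℤ` this is the pullback in equivariant cohomology. -/
def extPullback {X : τ.EqSheaf} {Y : τ'.EqSheaf} (s : Y ⟶ φ.inverseImage.obj X) (ε : ZMod 2)
    (n : ℕ) : Ext X (τ.unitary ε) n →+ Ext Y (τ'.unitary ε) n :=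
  ((Ext.mk₀ s).precomp _ (zero_add n)).comp
    (((Ext.mk₀ (φ.pullUnitary ε)).postcomp _ (add_zero n)).comp
      (φ.inverseImage.mapExtAddHom _ _ n))

theorem extPullback_apply {X : τ.EqSheaf} {Y : τ'.EqSheaf} (s : Y ⟶ φ.inverseImage.obj X)
    (ε : ZMod 2) (n : ℕ) (x : Ext X (τ.unitary ε) n) :
    φ.extPullback s ε n x = (Ext.mk₀ s).comp ((x.mapExactFunctor φ.inverseImage).comp
      (Ext.mk₀ (φ.pullUnitary ε)) (add_zero n)) (zero_add n) := rfl

theorem extPullback_mk₀ {X : τ.EqSheaf} {Y : τ'.EqSheaf} (s : Y ⟶ φ.inverseImage.obj X)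
    (ε : ZMod 2) (f : X ⟶ τ.unitary ε) :
    φ.extPullback s ε 0 (Ext.mk₀ f) =
      Ext.mk₀ (s ≫ φ.inverseImage.map f ≫ φ.pullUnitary ε) := by
  rw [extPullback_apply, Ext.mapExactFunctor_mk₀, Ext.mk₀_comp_mk₀, Ext.mk₀_comp_mk₀]

/-- Changing `X` along `p : X' ⟶ X` does not affect the pullback along a section that lifts to
`X'`. -/
theorem extPullback_precomp {X X' : τ.EqSheaf} {Y : τ'.EqSheaf} (p : X' ⟶ X)
    (s : Y ⟶ φ.inverseImage.obj X') (ε : ZMod 2) (n : ℕ) (x : Ext X (τ.unitary ε) n) :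
    φ.extPullback s ε n ((Ext.mk₀ p).comp x (zero_add n)) =
      φ.extPullback (s ≫ φ.inverseImage.map p) ε n x := by
  rw [extPullback_apply, extPullback_apply, Ext.mapExactFunctor_comp, Ext.mapExactFunctor_mk₀,
    Ext.comp_assoc_of_third_deg_zero, Ext.mk₀_comp_mk₀_assoc]

theorem mapExactFunctor_extensionClass {ε ε' : ZMod 2} (h : ε' = ε + 1) :
    ((τ.extensionClass h).mapExactFunctor φ.inverseImage).comp (Ext.mk₀ (φ.pullUnitary ε))
      (add_zero 1) = (Ext.mk₀ (φ.pullUnitary ε')).comp (τ'.extensionClass h) (zero_add 1) := by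
  have nat := ((τ.shortComplex_shortExact h).map_of_exact φ.inverseImage).extClass_naturality
    (τ'.shortComplex_shortExact h) (φ.pullShortComplex h)
  rw [← Ext.mapExactFunctor_extClass _ (τ.shortComplex_shortExact h)] at nat
  exact nat

/-- Pullback commutes with the connecting homomorphisms. -/
theorem extPullback_extensionClass {X : τ.EqSheaf} {Y : τ'.EqSheaf}
    (s : Y ⟶ φ.inverseImage.obj X) {ε ε' : ZMod 2} (h : ε' = ε + 1) (n : ℕ)
    (x : Ext X (τ.unitary ε') n) :
    φ.extPullback s ε (n + 1) (x.comp (τ.extensionClass h) rfl) =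
      (φ.extPullback s ε' n x).comp (τ'.extensionClass h) rfl := by
  rw [extPullback_apply, extPullback_apply, Ext.mapExactFunctor_comp,
    Ext.comp_assoc_of_third_deg_zero, mapExactFunctor_extensionClass,
    Ext.comp_assoc (a₂₃ := n + 1) _ _ _ (zero_add n) rfl (by lia),
    Ext.comp_assoc_of_second_deg_zero]

end EquivariantMap

/-! ### Pullback of invariant sections -/

namespace SmoothInvolution

variable (τ : SmoothInvolution I M)

/-- The constant equivariant sheaf `ℤ`. -/
abbrev constInt : τ.EqSheaf :=
  (constantSheaf τ.topology AddCommGrpCat.{u}).obj (AddCommGrpCat.of (ULift.{u} ℤ))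

/-- The unit section of the constant sheaf `ℤ`. -/
def constIntOne : InvariantSection τ.constInt ⟨⊤⟩ where
  act_mem _ _ _ := trivial
  hom := ((sheafificationAdjunction τ.topology AddCommGrpCat.{u}).unit.app
    ((Functor.const τ.EqOpensᵒᵖ).obj (AddCommGrpCat.of (ULift.{u} ℤ)))).app (op ⟨⊤⟩)
  invariant g := (((sheafificationAdjunction τ.topology AddCommGrpCat.{u}).unit.app
    ((Functor.const τ.EqOpensᵒᵖ).obj (AddCommGrpCat.of (ULift.{u} ℤ)))).naturality
      (Quiver.Hom.op (EqOpens.Hom.mk g (fun _ _ => trivial) : (⟨⊤⟩ : τ.EqOpens) ⟶ ⟨⊤⟩))).symm.trans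
        (Category.id_comp _)

variable {τ}

/-- The global section of `G` given by a morphism `ℤ ⟶ G`. -/
def evalOne (G : τ.EqSheaf) : (τ.constInt ⟶ G) →+ G.obj.obj (op ⟨⊤⟩) where
  toFun a := (a.hom.app (op ⟨⊤⟩)).hom (τ.constIntOne.hom.hom (ULift.up 1))
  map_zero' := rfl
  map_add' _ _ := rfl

theorem evalOne_injective (G : τ.EqSheaf) : Function.Injective (evalOne G) := by
  intro a b hab
  refine ((sheafificationAdjunction τ.topology AddCommGrpCat.{u}).homEquiv _ _).injective
    (NatTrans.ext (funext fun U => ?_))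
  let A := (Functor.const τ.EqOpensᵒᵖ).obj (AddCommGrpCat.of (ULift.{u} ℤ))
  let r : op (⟨⊤⟩ : τ.EqOpens) ⟶ U :=
    Quiver.Hom.op (EqOpens.Hom.mk 0 (fun _ _ => trivial) : U.unop ⟶ ⟨⊤⟩)
  let α : A ⟶ G.obj := (sheafificationAdjunction τ.topology AddCommGrpCat.{u}).homEquiv _ _ a
  let β : A ⟶ G.obj := (sheafificationAdjunction τ.topology AddCommGrpCat.{u}).homEquiv _ _ b
  have h : ∀ c : τ.constInt ⟶ G,
      ((sheafificationAdjunction τ.topology AddCommGrpCat.{u}).homEquiv A G c).app (op ⟨⊤⟩) =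
        τ.constIntOne.hom ≫ c.hom.app (op ⟨⊤⟩) := fun c =>
    congrArg (fun q => NatTrans.app q (op ⟨⊤⟩))
      (Adjunction.homEquiv_unit (sheafificationAdjunction τ.topology AddCommGrpCat.{u}) A G c)
  have key : α.app (op ⟨⊤⟩) = β.app (op ⟨⊤⟩) := by
    exact (h a).trans ((uliftInt_hom_ext hab).trans (h b).symm)
  change α.app U = β.app U
  refine (Category.id_comp _).symm.trans ((α.naturality r).trans (Eq.trans ?_
    ((β.naturality r).symm.trans (Category.id_comp _))))
  rw [key]

/-- A global invariant section of `X`, as a morphism of presheaves `ℤ ⟶ X`. -/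
def InvariantSection.presheafMap {X : τ.EqSheaf} {W : τ.EqOpens} (t : InvariantSection X W)
    (hW : ∀ x, x ∈ W.carrier) :
    (Functor.const τ.EqOpensᵒᵖ).obj (AddCommGrpCat.of (ULift.{u} ℤ)) ⟶ X.obj where
  app U := t.hom ≫ X.obj.map
    (Quiver.Hom.op (EqOpens.Hom.mk 0 (fun x _ => hW x) : U.unop ⟶ W))
  naturality U V f := by
    have h : (EqOpens.Hom.mk 0 (fun x _ => hW x) : V.unop ⟶ W) ≫
        (EqOpens.Hom.mk f.unop.elt (t.act_mem _) : W ⟶ W) =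
        f.unop ≫ (EqOpens.Hom.mk 0 (fun x _ => hW x) : U.unop ⟶ W) :=
      EqOpens.hom_ext (add_comm _ _)
    refine (Category.id_comp _).trans ?_
    rw [Category.assoc, ← Functor.map_comp, ← t.invariant f.unop.elt,
      Category.assoc, ← Functor.map_comp, ← op_comp, h, t.invariant]
    rfl

/-- A global invariant section of `X`, as a morphism of sheaves `ℤ ⟶ X`. -/
def InvariantSection.toHom {X : τ.EqSheaf} {W : τ.EqOpens} (t : InvariantSection X W)
    (hW : ∀ x, x ∈ W.carrier) : τ.constInt ⟶ X :=
  ((sheafificationAdjunction τ.topology AddCommGrpCat.{u}).homEquiv _ _).symm (t.presheafMap hW)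

theorem InvariantSection.constIntOne_toHom {X : τ.EqSheaf} {W : τ.EqOpens}
    (t : InvariantSection X W) (hW : ∀ x, x ∈ W.carrier) :
    τ.constIntOne.hom ≫ (t.toHom hW).hom.app (op ⟨⊤⟩) = t.hom ≫ X.obj.map
      (Quiver.Hom.op (EqOpens.Hom.mk 0 (fun x _ => hW x) : ⟨⊤⟩ ⟶ W)) := by
  have h := Adjunction.homEquiv_unit (sheafificationAdjunction τ.topology AddCommGrpCat.{u}) _ _
    (t.toHom hW)
  rw [InvariantSection.toHom, Equiv.apply_symm_apply] at h
  exact (congrArg (fun q => NatTrans.app q (op ⟨⊤⟩)) h).symm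

theorem InvariantSection.constIntOne_toHom_comp {X Y : τ.EqSheaf} {W : τ.EqOpens}
    (t : InvariantSection X W) (hW : ∀ x, x ∈ W.carrier) (p : X ⟶ Y) :
    τ.constIntOne.hom ≫ (t.toHom hW ≫ p).hom.app (op ⟨⊤⟩) = t.hom ≫ p.hom.app (op W) ≫ Y.obj.map
      (Quiver.Hom.op (EqOpens.Hom.mk 0 (fun x _ => hW x) : ⟨⊤⟩ ⟶ W)) := by
  refine (Category.assoc _ _ _).symm.trans ?_
  rw [constIntOne_toHom]
  exact (Category.assoc _ _ _).trans (congrArg (fun q => t.hom ≫ q) (p.hom.naturality _))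

end SmoothInvolution

namespace EquivariantMap

open SmoothInvolution

variable {τ' : SmoothInvolution J N} {τ : SmoothInvolution I M} (φ : EquivariantMap τ' τ)

theorem unit_naturality_app (X : τ.EqSheaf) {V W : τ.EqOpens} (r : V ⟶ W) :
    X.obj.map r.op ≫ (φ.adjunction.unit.app X).hom.app (op V) =
      (φ.adjunction.unit.app X).hom.app (op W) ≫
        (φ.inverseImage.obj X).obj.map (φ.preimage.map r).op :=
  (φ.adjunction.unit.app X).hom.naturality r.op

/-- The pullback of an invariant section over `W`, as an invariant section over `φ⁻¹ W`. -/
def pullSection {X : τ.EqSheaf} {W : τ.EqOpens} (t : InvariantSection X W) :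
    InvariantSection (φ.inverseImage.obj X) (φ.preimage.obj W) where
  act_mem g x hx := by
    change φ.toFun (τ'.act g x) ∈ W.carrier
    rw [map_act]; exact t.act_mem g _ hx
  hom := t.hom ≫ (φ.adjunction.unit.app X).hom.app (op W)
  invariant g := by
    refine (Category.assoc _ _ _).trans ((congrArg (fun q => t.hom ≫ q)
      (φ.unit_naturality_app X (EqOpens.Hom.mk g (t.act_mem g) : W ⟶ W)).symm).trans ?_)
    exact (Category.assoc _ _ _).symm.trans (congrArg
      (fun q => q ≫ (φ.adjunction.unit.app X).hom.app (op W)) (t.invariant g))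

/-- The pullback of an invariant section `t` of `X`, defined on a neighbourhood of the image of
`φ`: it is a global section of `φ⁻¹ X`. -/
def sectionMap {X : τ.EqSheaf} {W : τ.EqOpens} (t : InvariantSection X W)
    (hW : ∀ x, φ.toFun x ∈ W.carrier) : τ'.constInt ⟶ φ.inverseImage.obj X :=
  (φ.pullSection t).toHom hW

/-- The section obtained from a pulled back section and a morphism `k : φ⁻¹ X ⟶ G` may be
computed on `M`, with the morphism `X ⟶ φ_* G` adjoint to `k`. -/
theorem evalOne_sectionMap_comp {X : τ.EqSheaf} {W : τ.EqOpens} (t : InvariantSection X W)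
    (hW : ∀ x, φ.toFun x ∈ W.carrier) {G : τ'.EqSheaf} (k : φ.inverseImage.obj X ⟶ G) :
    evalOne G (φ.sectionMap t hW ≫ k) = (G.obj.map (Quiver.Hom.op
      (EqOpens.Hom.mk 0 (fun x _ => hW x) : ⟨⊤⟩ ⟶ φ.preimage.obj W))).hom
        (((φ.adjunction.homEquiv _ _ k).hom.app (op W)).hom (t.hom.hom (ULift.up 1))) := by
  rw [Adjunction.homEquiv_unit]
  exact congrArg (fun q => q.hom (ULift.up 1)) ((φ.pullSection t).constIntOne_toHom_comp hW k)

theorem pullSection_comp {X X' : τ.EqSheaf} (p : X' ⟶ X) {W W' : τ.EqOpens}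
    (h : W'.carrier ≤ W.carrier) (t : InvariantSection X W) (t' : InvariantSection X' W')
    (e : t'.hom ≫ p.hom.app (op W') = t.hom ≫ X.obj.map (EqOpens.incl h).op) :
    (φ.pullSection t').hom ≫ (φ.inverseImage.map p).hom.app (op (φ.preimage.obj W')) =
      (φ.pullSection t).hom ≫
        (φ.inverseImage.obj X).obj.map (φ.preimage.map (EqOpens.incl h)).op := by
  have nat : (φ.adjunction.unit.app X').hom.app (op W') ≫
      (φ.inverseImage.map p).hom.app (op (φ.preimage.obj W')) =
      p.hom.app (op W') ≫ (φ.adjunction.unit.app X).hom.app (op W') :=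
    congrArg (fun q => q.hom.app (op W')) (φ.adjunction.unit_naturality p)
  refine (Category.assoc _ _ _).trans ((congrArg (fun q => t'.hom ≫ q) nat).trans ?_)
  refine (Category.assoc _ _ _).symm.trans ((congrArg
    (fun q => q ≫ (φ.adjunction.unit.app X).hom.app (op W')) e).trans ?_)
  refine (Category.assoc _ _ _).trans (Eq.trans ?_ (Category.assoc _ _ _).symm)
  exact congrArg (fun q => t.hom ≫ q) (φ.unit_naturality_app X (EqOpens.incl h))

/-- Pullback of invariant sections is compatible with morphisms of sheaves and restriction. -/
theorem sectionMap_comp_inverseImage_map {X X' : τ.EqSheaf} (p : X' ⟶ X) {W W' : τ.EqOpens}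
    (h : W'.carrier ≤ W.carrier) (t : InvariantSection X W) (t' : InvariantSection X' W')
    (e : t'.hom ≫ p.hom.app (op W') = t.hom ≫ X.obj.map (EqOpens.incl h).op)
    (hW' : ∀ x, φ.toFun x ∈ W'.carrier) :
    φ.sectionMap t' hW' ≫ φ.inverseImage.map p = φ.sectionMap t fun x => h (hW' x) := by
  refine evalOne_injective _ (congrArg (fun q => q.hom (ULift.up 1)) (?_ :
    τ'.constIntOne.hom ≫ (φ.sectionMap t' hW' ≫ φ.inverseImage.map p).hom.app (op ⟨⊤⟩) =
      τ'.constIntOne.hom ≫ (φ.sectionMap t fun x => h (hW' x)).hom.app (op ⟨⊤⟩)))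
  refine ((φ.pullSection t').constIntOne_toHom_comp hW' _).trans
    (Eq.trans ?_ ((φ.pullSection t).constIntOne_toHom _).symm)
  rw [← Category.assoc, φ.pullSection_comp p h t t' e, Category.assoc, ← Functor.map_comp]
  rfl

/-- The pullback of a circle-valued function is its composition with `φ`. -/
theorem evalOne_sectionMap_pullUnitary_val {X : τ.EqSheaf} {W : τ.EqOpens}
    (t : InvariantSection X W) (hW : ∀ x, φ.toFun x ∈ W.carrier) (ε : ZMod 2)
    (f : X ⟶ τ.unitary ε) (x : N) :
    Sec.val (evalOne _ (φ.sectionMap t hW ≫ φ.inverseImage.map f ≫ φ.pullUnitary ε) :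
      Sec J (⊤ : Opens N)) x trivial =
      Sec.val ((f.hom.app (op W)).hom (t.hom.hom (ULift.up 1)) : Sec I W.carrier) (φ.toFun x)
        (hW x) := by
  rw [evalOne_sectionMap_comp, Adjunction.homEquiv_naturality_left, pullUnitary,
    Equiv.apply_symm_apply]
  refine (τ'.unitaryPresheaf_map_val ε _ _ _ _).trans ?_
  exact conj_zero _ _

end EquivariantMap

/-! ### Equivariant cohomology of the point -/

section ZModTwo

variable {G : Type*} [AddCommGroup G]

theorem exists_addEquiv_zmod_two {c : G} (hc : c ≠ 0) (h : ∀ x : G, x = 0 ∨ x = c) :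
    Nonempty (G ≃+ ZMod 2) := by
  have hcard : Nat.card G = 2 := by
    rw [Nat.card_eq_two_iff]
    refine ⟨0, c, hc.symm, Set.eq_univ_of_forall fun x => ?_⟩
    simpa using h x
  have : Fact (Nat.Prime 2) := ⟨Nat.prime_two⟩
  exact ⟨addEquivOfPrimeCardEq (p := 2) hcard (by simp)⟩

theorem addEquiv_zmod_two_apply (e : G ≃+ ZMod 2) (c : G) [Decidable (c = 0)] :
    e c = if c = 0 then 0 else 1 := by
  have key : ∀ x : ZMod 2, x = 0 ∨ x = 1 := by decide
  split_ifs with h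
  · rw [h, map_zero]
  · exact (key _).resolve_left fun h' => h (e.map_eq_zero_iff.1 h')

end ZModTwo

theorem circle_eq_or_of_neg_eq {z : Additive Circle} (h : -z = z) :
    z = 0 ∨ z = Additive.ofMul (-1) := by
  have h1 : (z.toMul : ℂ) * z.toMul = 1 := by
    have h2 : z.toMul⁻¹ = z.toMul := congrArg Additive.toMul h
    have h3 : z.toMul * z.toMul = 1 := by
      nth_rewrite 1 [← h2]
      exact inv_mul_cancel _
    exact_mod_cast congrArg (fun w : Circle => (w : ℂ)) h3
  rcases mul_self_eq_one_iff.1 h1 with h | h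
  · exact Or.inl (congrArg Additive.ofMul (Circle.ext h : z.toMul = 1))
  · exact Or.inr (congrArg Additive.ofMul (Circle.ext (by simpa using h) : z.toMul = -1))

theorem ofMul_neg_one_ne_zero : (Additive.ofMul (-1) : Additive Circle) ≠ 0 := by
  intro h
  have h1 : (-1 : Circle) = 1 := congrArg Additive.toMul h
  have h2 : (-1 : ℂ) = 1 := by simpa using congrArg (fun w : Circle => (w : ℂ)) h1
  norm_num at h2

namespace SmoothInvolution

open Abelian

theorem evalOne_invariant {τ : SmoothInvolution I M} {G : τ.EqSheaf} (a : τ.constInt ⟶ G)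
    (g : ZMod 2) :
    (G.obj.map (Quiver.Hom.op (EqOpens.Hom.mk g (fun _ _ => trivial) :
      (⟨⊤⟩ : τ.EqOpens) ⟶ ⟨⊤⟩))).hom (evalOne G a) = evalOne G a := by
  refine (EqSheaf.naturality_apply a _ _).symm.trans ?_
  exact congrArg (fun q => (a.hom.app (op ⟨⊤⟩)).hom (q.hom (ULift.up 1)))
    (τ.constIntOne.invariant g)

/-- The value at a fixed point of an invariant section of `𝒰^1` is real. -/
theorem InvariantSection.neg_val_eq {τ : SmoothInvolution I M} {W : τ.EqOpens}
    (t : InvariantSection (τ.unitary 1) W) {m : M} (hm : m ∈ W.carrier) (hfix : τ.toFun m = m) :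
    -Sec.val (t.hom.hom (ULift.up 1) : Sec I W.carrier) m hm =
      Sec.val (t.hom.hom (ULift.up 1) : Sec I W.carrier) m hm := by
  let s : Sec I W.carrier := t.hom.hom (ULift.up 1)
  have h := congrArg (fun q => Sec.val (q.hom (ULift.up 1) : Sec I W.carrier) m hm) (t.invariant 1)
  have h' := τ.unitaryPresheaf_map_val 1 (EqOpens.Hom.mk 1 (t.act_mem 1) : W ⟶ W) s m hm
  refine Eq.trans ?_ (h'.symm.trans h)
  have hs : s.val (τ.act 1 m) (t.act_mem 1 m hm) = s.val m hm :=
    Sec.val_congr s (act_fixed hfix 1) _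
  change -(s.val m hm) = conj 1 1 _ (s.val (τ.act 1 m) (t.act_mem 1 m hm))
  rw [hs]
  simp [conj]

/-- Over a point, every open set containing a given point is everything, so that local vanishing is
vanishing. -/
theorem point_ext_induced_eq_zero (n : ℕ)
    (y : Ext pointInvolution.{u}.constInt pointInvolution.{u}.induced (n + 1)) : y = 0 := by
  obtain ⟨X', p, hp, e⟩ := exists_liftsInvariantSections_comp_induced_eq_zero n _ y
  obtain ⟨W', h, t', hm, ht'⟩ := hp ⟨⊤⟩ pointInvolution.{u}.constIntOne PUnit.unit trivial rfl
  -- the lift of the unit section splits `p`, while `p` annihilates `y`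
  have hs : t'.toHom (fun _ => hm) ≫ p = 𝟙 _ := by
    refine evalOne_injective _ (congrArg (fun q => q.hom (ULift.up 1))
      ((t'.constIntOne_toHom_comp (fun _ => hm) p).trans ?_))
    rw [← Category.assoc, ht', Category.assoc, ← Functor.map_comp]
    refine (congrArg (fun q => pointInvolution.{u}.constIntOne.hom ≫ q)
      (CategoryTheory.Functor.map_id _ (op (⟨⊤⟩ : pointInvolution.{u}.EqOpens)))).trans ?_
    rfl
  rw [← Ext.mk₀_id_comp y, ← hs, ← Ext.mk₀_comp_mk₀_assoc, e, Ext.comp_zero]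

theorem point_norm_eq_zero (f : pointInvolution.{u}.constInt ⟶ pointInvolution.{u}.induced) :
    f ≫ pointInvolution.{u}.norm 1 = 0 := by
  refine evalOne_injective _ (Sec.ext fun x hx => ?_)
  let a : pointInvolution.{u}.InducedSec (⊤ : Opens PUnit.{u + 1}) := evalOne _ f
  have h1 : (a 1).val x trivial = (a 0).val x trivial :=
    congrArg (fun b : pointInvolution.{u}.InducedSec (⊤ : Opens PUnit.{u + 1}) =>
      (b 0).val x trivial) (evalOne_invariant f 1)
  have h2 := pointInvolution.{u}.normHom_val 1 ⊤ a x hx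
  refine h2.trans ?_
  have hs : ∀ F : ZMod 2 → Additive Circle, ∑ h, F h = F 0 + F 1 := fun F => Fin.sum_univ_two F
  rw [hs, conj_zero]
  change (a 0).val x trivial + conj 1 1 _ ((a 1).val x trivial) = 0
  rw [h1]
  simp [conj]

/-- The connecting homomorphisms of the point are isomorphisms. In degree zero this uses that the
norm of an invariant element of `ind U(1)` is `z · z̄ = 1`. -/
theorem point_gerbeConnecting_bijective (n : ℕ) :
    Function.Bijective (pointInvolution.{u}.gerbeConnecting n) := by
  have hS := pointInvolution.{u}.shortComplex_shortExact (parity_succ n)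
  constructor
  · refine (injective_iff_map_eq_zero _).2 fun x hx => ?_
    obtain ⟨x₂, rfl⟩ := Ext.covariant_sequence_exact₃ _ hS x rfl hx
    cases n with
    | zero =>
      obtain ⟨f, rfl⟩ := (Ext.mk₀_bijective _ _).2 x₂
      rw [Ext.mk₀_comp_mk₀]
      refine (Ext.mk₀_eq_zero_iff _).2 ?_
      exact point_norm_eq_zero f
    | succ n =>
      exact (congrArg (fun w => Ext.comp w (Ext.mk₀ (pointInvolution.{u}.shortComplex
        (parity_succ (n + 1))).g) (add_zero (n + 1))) (point_ext_induced_eq_zero n x₂)).trans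
          (Ext.zero_comp _ _ _ _ _)
  · intro y
    exact Ext.covariant_sequence_exact₁ _ hS y (point_ext_induced_eq_zero n _) rfl

/-- Invariant circle-valued functions on the point are the elements `1` and `-1`. -/
theorem point_gerbeClass_zero : Nonempty (pointInvolution.{u}.GerbeClass 0 ≃+ ZMod 2) := by
  let pt := pointInvolution.{u}
  suffices h : Nonempty ((pt.constInt ⟶ pt.unitary 1) ≃+ ZMod 2) from
    ⟨(Ext.addEquiv₀ (X := pt.constInt) (Y := pt.unitary 1)).trans h.some⟩
  -- the constant function `-1`, as an invariant section and as a morphism `ℤ ⟶ 𝒰^1`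
  let s : Sec 𝓘(ℝ, PUnit.{u + 1}) (⊤ : Opens PUnit.{u + 1}) :=
    Additive.ofMul ⟨fun _ => -1, contMDiff_const⟩
  obtain ⟨t, ht⟩ := exists_uliftInt_hom (B := (pt.unitary 1).obj.obj (op ⟨⊤⟩)) s
  have hinv : ∀ g : ZMod 2, pt.unitaryMap 1
      (EqOpens.Hom.mk g (fun _ _ => trivial) : (⟨⊤⟩ : pt.EqOpens) ⟶ ⟨⊤⟩) s = s := by
    intro g
    refine Sec.ext fun x hx => (pt.unitaryMap_val 1 _ s x hx).trans ?_
    have hneg : -(Additive.ofMul (-1) : Additive Circle) = Additive.ofMul (-1) :=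
      congrArg Additive.ofMul (inv_neg_one : (-1 : Circle)⁻¹ = -1)
    change conj 1 g _ (Additive.ofMul (-1)) = Additive.ofMul (-1)
    unfold conj
    split_ifs
    exacts [rfl, hneg]
  let T : InvariantSection (pt.unitary 1) ⟨⊤⟩ :=
    { act_mem := fun _ _ _ => trivial
      hom := t
      invariant := fun g => uliftInt_hom_ext (by
        refine (congrArg (pt.unitaryMap 1 (EqOpens.Hom.mk g (fun _ _ => trivial) :
          (⟨⊤⟩ : pt.EqOpens) ⟶ ⟨⊤⟩)) ht).trans ((hinv g).trans ht.symm)) }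
  have hT : evalOne _ (T.toHom fun _ => trivial) = s := by
    refine (congrArg (fun q => q.hom (ULift.up 1)) (T.constIntOne_toHom fun _ => trivial)).trans ?_
    exact (congrArg (pt.unitaryMap 1 (EqOpens.Hom.mk 0 (fun _ _ => trivial) :
          (⟨⊤⟩ : pt.EqOpens) ⟶ ⟨⊤⟩)) ht).trans (hinv 0)
  refine exists_addEquiv_zmod_two (c := T.toHom fun _ => trivial) (fun h => ?_) fun f => ?_
  · rw [h, map_zero] at hT
    exact ofMul_neg_one_ne_zero (congrArg (fun s : Sec 𝓘(ℝ, PUnit.{u + 1})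
      (⊤ : Opens PUnit.{u + 1}) => s.val PUnit.unit trivial) hT).symm
  · have hf := (pt.constIntOne.map f).neg_val_eq (m := PUnit.unit) trivial rfl
    refine (circle_eq_or_of_neg_eq hf).imp (fun h => ?_) fun h => ?_
    · exact evalOne_injective _ (Sec.ext fun _ _ => h)
    · exact evalOne_injective _ ((Sec.ext fun _ _ => h :
        (evalOne _ f : Sec 𝓘(ℝ, PUnit.{u + 1}) (⊤ : Opens PUnit.{u + 1})) = s).trans hT.symm)

theorem point_gerbeClass (n : ℕ) : Nonempty (pointInvolution.{u}.GerbeClass n ≃+ ZMod 2) := by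
  induction n with
  | zero => exact point_gerbeClass_zero
  | succ n ih =>
    exact ⟨(AddEquiv.ofBijective _ (point_gerbeConnecting_bijective n)).symm.trans ih.some⟩

theorem pointSign_congr {n : ℕ} {c c' : pointInvolution.{u}.GerbeClass n} (h : c = 0 ↔ c' = 0) :
    pointSign n c = pointSign n c' := by
  classical exact if_congr h rfl rfl

theorem pointSign_gerbeConnecting (n : ℕ) (c : pointInvolution.{u}.GerbeClass n) :
    pointSign (n + 1) (pointInvolution.{u}.gerbeConnecting n c) = pointSign n c := by
  unfold pointSign
  rw [map_eq_zero_iff _ (point_gerbeConnecting_bijective n).1]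

/-! ### Sign choices -/

variable {τ : SmoothInvolution I M}

/-- The sign at the fixed point `m` of an extension class with values in `𝒰^{[n+1]}`, relative to an
invariant section `t` defined near `m`. -/
def extSign {X : τ.EqSheaf} {W : τ.EqOpens} (t : InvariantSection X W) (n : ℕ)
    (x : Ext X (τ.unitary ((n + 1 : ℕ) : ZMod 2)) n) (m : τ.FixedPoints) (hm : m.1 ∈ W.carrier) :
    ZMod 2 :=
  pointSign n ((τ.pointInclusion m).extPullback ((τ.pointInclusion m).sectionMap t fun _ => hm) _ n
    x)

/-- For the unit section of `X = ℤ`, the morphism `sectionMap` is by definition the canonical map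
`constMap`, so `extSign` is the sign choice. -/
theorem signChoice_eq_extSign (n : ℕ) (ξ : τ.GerbeClass n) (m : τ.FixedPoints) :
    τ.signChoice n ξ m = extSign τ.constIntOne n ξ m trivial := rfl

theorem extSign_extensionClass {X : τ.EqSheaf} {W : τ.EqOpens} (t : InvariantSection X W) (n : ℕ)
    (x : Ext X (τ.unitary ((n + 1 : ℕ) : ZMod 2)) n) (m : τ.FixedPoints) (hm : m.1 ∈ W.carrier) :
    extSign t (n + 1) (x.comp (τ.extensionClass (parity_succ n)) rfl) m hm =
      extSign t n x m hm := by
  unfold extSign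
  rw [EquivariantMap.extPullback_extensionClass]
  exact pointSign_gerbeConnecting n _

/-- Signs are unchanged when `X` is replaced by a sheaf to which the invariant section lifts near
`m`. -/
theorem extSign_precomp {X X' : τ.EqSheaf} (p : X' ⟶ X) {W W' : τ.EqOpens}
    (h : W'.carrier ≤ W.carrier) (t : InvariantSection X W) (t' : InvariantSection X' W')
    (e : t'.hom ≫ p.hom.app (op W') = t.hom ≫ X.obj.map (EqOpens.incl h).op) (n : ℕ)
    (x : Ext X (τ.unitary ((n + 1 : ℕ) : ZMod 2)) n) (m : τ.FixedPoints) (hm : m.1 ∈ W'.carrier) :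
    extSign t' n ((Ext.mk₀ p).comp x (zero_add n)) m hm = extSign t n x m (h hm) := by
  unfold extSign
  rw [EquivariantMap.extPullback_precomp]
  exact congrArg (fun s => pointSign n ((τ.pointInclusion m).extPullback s _ n x))
    ((τ.pointInclusion m).sectionMap_comp_inverseImage_map p h t t' e fun _ => hm)

theorem extPullback_mk₀_eq_zero_iff {X : τ.EqSheaf} {W : τ.EqOpens} (t : InvariantSection X W)
    (f : X ⟶ τ.unitary 1) (m : τ.FixedPoints) (hm : m.1 ∈ W.carrier) :
    (τ.pointInclusion m).extPullback ((τ.pointInclusion m).sectionMap t fun _ => hm) 1 0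
      (Ext.mk₀ f) = 0 ↔
      Sec.val ((t.map f).hom.hom (ULift.up 1) : Sec I W.carrier) m.1 hm = 0 := by
  have hv := (τ.pointInclusion m).evalOne_sectionMap_pullUnitary_val t (fun _ => hm) 1 f PUnit.unit
  rw [EquivariantMap.extPullback_mk₀, Ext.mk₀_eq_zero_iff,
    ← map_eq_zero_iff _ (evalOne_injective _)]
  refine ⟨fun h => ?_, fun h => Sec.ext fun x _ => hv.trans h⟩
  rw [h] at hv
  exact hv.symm

/-- An invariant circle-valued function takes the values `1` and `-1` at fixed points, and by
continuity it takes the same value at all nearby fixed points. -/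
theorem exists_extSign_zero_eq {X : τ.EqSheaf} {W : τ.EqOpens} (t : InvariantSection X W)
    (f : X ⟶ τ.unitary 1) (m : τ.FixedPoints) (hm : m.1 ∈ W.carrier) :
    ∃ (V : Opens M) (h : V ≤ W.carrier), m.1 ∈ V ∧ ∀ (m' : τ.FixedPoints) (hm' : m'.1 ∈ V),
      extSign t 0 (Ext.mk₀ f) m' (h hm') = extSign t 0 (Ext.mk₀ f) m hm := by
  let s : Sec I W.carrier := (t.map f).hom.hom (ULift.up 1)
  have hs : ∀ (m' : τ.FixedPoints) (hm' : m'.1 ∈ W.carrier), s.val m'.1 hm' = 0 ∨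
      s.val m'.1 hm' = Additive.ofMul (-1) := fun m' hm' =>
    circle_eq_or_of_neg_eq ((t.map f).neg_val_eq hm' m'.2)
  have hcont : Continuous s.toMul := s.toMul.contMDiff.continuous
  -- `V` is the set where `s` avoids `z = -s m`; the only other value at a fixed point is `s m`
  let z : Circle := -s.toMul ⟨m.1, hm⟩
  let V : Opens M := ⟨Subtype.val '' (s.toMul ⁻¹' {z}ᶜ),
    W.carrier.isOpen.isOpenMap_subtype_val _ (isOpen_compl_singleton.preimage hcont)⟩
  have hV : V ≤ W.carrier := by
    rintro _ ⟨x, -, rfl⟩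
    exact x.2
  have hne : ∀ w : Circle, w ≠ -w := by
    intro w h
    have h1 : (w : ℂ) = -(w : ℂ) := by simpa using congrArg (fun w : Circle => (w : ℂ)) h
    exact w.coe_ne_zero (self_eq_neg.1 h1)
  refine ⟨V, hV, ⟨⟨m.1, hm⟩, hne _, rfl⟩, fun m' hm' => ?_⟩
  have hval : s.val m'.1 (hV hm') = s.val m.1 hm := by
    have hz : s.toMul ⟨m'.1, hV hm'⟩ ≠ z := by
      obtain ⟨x, hx, hxm⟩ := id hm'
      intro h
      refine hx ?_
      have : x = ⟨m'.1, hV hm'⟩ := Subtype.ext hxm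
      rw [this]; exact h
    have e1 : s.val m'.1 (hV hm') = Additive.ofMul (s.toMul ⟨m'.1, hV hm'⟩) := rfl
    have e2 : s.val m.1 hm = Additive.ofMul (s.toMul ⟨m.1, hm⟩) := rfl
    rcases hs m' (hV hm') with h | h <;> rcases hs m hm with h' | h'
    · rw [h, h']
    · refine absurd ?_ hz
      have h1 : s.toMul ⟨m'.1, hV hm'⟩ = 1 := congrArg Additive.toMul h
      have h2 : s.toMul ⟨m.1, hm⟩ = -1 := congrArg Additive.toMul h'
      change _ = -s.toMul ⟨m.1, hm⟩
      rw [h1, h2, neg_neg]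
    · refine absurd ?_ hz
      have h1 : s.toMul ⟨m'.1, hV hm'⟩ = -1 := congrArg Additive.toMul h
      have h2 : s.toMul ⟨m.1, hm⟩ = 1 := congrArg Additive.toMul h'
      change _ = -s.toMul ⟨m.1, hm⟩
      rw [h1, h2]
    · rw [h, h']
  refine pointSign_congr ((extPullback_mk₀_eq_zero_iff t f m' (hV hm')).trans
    (Iff.trans ?_ (extPullback_mk₀_eq_zero_iff t f m hm).symm))
  exact Eq.congr_left hval

/-- In positive degree the image of the class in the cohomology of `ind 𝒰(1)` vanishes near `m`, so
near `m` the class is in the image of a connecting homomorphism, which preserves signs. -/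
theorem exists_extSign_eq (n : ℕ) {X : τ.EqSheaf} {W : τ.EqOpens} (t : InvariantSection X W)
    (x : Ext X (τ.unitary ((n + 1 : ℕ) : ZMod 2)) n) (m : τ.FixedPoints) (hm : m.1 ∈ W.carrier) :
    ∃ (V : Opens M) (h : V ≤ W.carrier), m.1 ∈ V ∧ ∀ (m' : τ.FixedPoints) (hm' : m'.1 ∈ V),
      extSign t n x m' (h hm') = extSign t n x m hm := by
  induction n generalizing X W with
  | zero =>
    obtain ⟨f, rfl⟩ := (Ext.mk₀_bijective _ _).2 x
    exact exists_extSign_zero_eq t f m hm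
  | succ n ih =>
    obtain ⟨X', p, hp, e⟩ := exists_liftsInvariantSections_comp_induced_eq_zero n X
      (x.comp (Ext.mk₀ (τ.toInduced _)) (add_zero _))
    rw [← Ext.comp_assoc_of_third_deg_zero] at e
    obtain ⟨x', hx'⟩ := Ext.covariant_sequence_exact₁ X'
      (τ.shortComplex_shortExact (parity_succ n)) _ e rfl
    -- near `m` the signs of `x` are those of `x'`, which has lower degree
    obtain ⟨W', h, t', hm', ht'⟩ := hp W t m.1 hm m.2
    obtain ⟨V, hV, hmV, hsign⟩ := ih t' x' hm'
    have key : ∀ (m' : τ.FixedPoints) (hm' : m'.1 ∈ W'.carrier),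
        extSign t (n + 1) x m' (h hm') = extSign t' n x' m' hm' := by
      intro m' hm'
      rw [← extSign_precomp p h t t' ht' (n + 1) x m' hm', ← hx']
      exact extSign_extensionClass t' n x' m' hm'
    refine ⟨V, hV.trans h, hmV, fun m' hm'' => ?_⟩
    exact (key m' (hV hm'')).trans ((hsign m' hm'').trans (key m hm').symm)

theorem isLocallyConstant_signChoice (n : ℕ) (ξ : τ.GerbeClass n) :
    IsLocallyConstant (τ.signChoice n ξ) := by
  rw [IsLocallyConstant.iff_exists_open]
  intro m
  obtain ⟨V, h, hm, hV⟩ := exists_extSign_eq n τ.constIntOne ξ m trivial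
  refine ⟨Subtype.val ⁻¹' V, V.isOpen.preimage continuous_subtype_val, hm, fun m' hm' => ?_⟩
  rw [signChoice_eq_extSign, signChoice_eq_extSign]
  exact hV m' hm'

theorem signChoice_gerbeConnecting (n : ℕ) (ξ : τ.GerbeClass n) :
    τ.signChoice (n + 1) (τ.gerbeConnecting n ξ) = τ.signChoice n ξ :=
  funext fun m => by
    rw [signChoice_eq_extSign, signChoice_eq_extSign]
    exact extSign_extensionClass τ.constIntOne n ξ m trivial

end SmoothInvolution

end Orientifold

end

theorem mainTheorem1 {E : Type*} [NormedAddCommGroup E] [NormedSpace ℝ E] {H : Type*}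
    [TopologicalSpace H] (I : ModelWithCorners ℝ E H) (M : Type u) [TopologicalSpace M]
    [ChartedSpace H M] [IsManifold I ∞ M] (τ : Orientifold.SmoothInvolution I M) :
    (∀ n : ℕ, ∃ e : Orientifold.pointInvolution.{u}.GerbeClass n ≃+ ZMod 2,
      ∀ c, e c = Orientifold.SmoothInvolution.pointSign n c) ∧
    (∀ (n : ℕ) (ξ : τ.GerbeClass n), IsLocallyConstant (τ.signChoice n ξ)) ∧
    ∀ (n : ℕ) (ξ : τ.GerbeClass n),
      τ.signChoice (n + 1) (τ.gerbeConnecting n ξ) = τ.signChoice n ξ := by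
  refine ⟨fun n => ?_, Orientifold.SmoothInvolution.isLocallyConstant_signChoice,
    Orientifold.SmoothInvolution.signChoice_gerbeConnecting⟩
  obtain ⟨e⟩ := Orientifold.SmoothInvolution.point_gerbeClass.{u} n
  classical exact ⟨e, fun c => Orientifold.addEquiv_zmod_two_apply e c⟩
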